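/- Let $p$ be a prime, let $L$ be a finite extension of $\mathbb{Q}_p$, and let $n\ge 0$ be an integer. Let $X$ be a rigid analytic space over $L$ (in the sense of Tate, so that its points are the classical ones) of dimension $n$, and let $(Y_j)_{j\in\mathbb{N}}$ be a countable family of Zariski-closed analytic subspaces of $X$ (that is, closed immersions $Y_j\to X$ of rigid analytic spaces over $L$) with $\dim Y_j<n$ for every $j$. Then $X\neq\bigcup_{j\in\mathbb{N}}Y_j$, i.e. some point of $X$ lies in no $Y_j$. Here the dimension of a rigid analytic space is the supremum of the Krull dimensions of the rings $\mathcal{O}(U)$ over its affinoid open subspaces $U$, the dimension of the empty space being $-\infty$. -/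

import Mathlib

/-! Classical (Tate) rigid analytic geometry over a complete non-archimedean field `L`:
affinoid algebras, their maximal spectra with the strong Grothendieck topology, rigid analytic
spaces as `G`-ringed spaces, closed immersions and dimension. -/

namespace Rigid

universe u v w v' w'

section Affinoid

variable (L : Type u) [NontriviallyNormedField L] [IsUltrametricDist L]

/-- The Tate algebra `L⟨T₁, …, Tₘ⟩`: power series whose coefficients tend to `0`. -/
def tateAlgebra (m : ℕ) : Subalgebra L (MvPowerSeries (Fin m) L) where
  __ := MvPowerSeries.IsRestricted.subring (R := L) (fun _ : Fin m => (1 : ℝ))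
  algebraMap_mem' a := MvPowerSeries.isRestricted_C _ a

/-- An affinoid algebra: an `L`-algebra isomorphic to a quotient of a Tate algebra. -/
def IsAffinoidAlgebra (A : Type w) [CommRing A] [Algebra L A] : Prop :=
  ∃ (m : ℕ) (φ : tateAlgebra L m →ₐ[L] A), Function.Surjective φ

variable {A : Type w} [CommRing A] [Algebra L A]

/-- `|f(x)|` for a maximal ideal `x` of an affinoid algebra `A` and `f ∈ A`: the value at the
residue class of `f` of the unique extension of the absolute value of `L` to the finite field
extension `A / x` of `L` (the spectral value of the minimal polynomial). -/
noncomputable def absAt (x : MaximalSpectrum A) (f : A) : ℝ :=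
  spectralValue (minpoly L (Ideal.Quotient.mk x.asIdeal f))

/-- Rational subdomains `{x | |f₁(x)| ≤ |g(x)|, …, |fᵣ(x)| ≤ |g(x)|}` of `Sp A`, where
`f₁, …, fᵣ, g` generate the unit ideal. -/
def IsRationalSubdomain (W : Set (MaximalSpectrum A)) : Prop :=
  ∃ (r : ℕ) (f : Fin r → A) (g : A), Ideal.span (insert g (Set.range f)) = ⊤ ∧
    W = {x | ∀ i, absAt L x (f i) ≤ absAt L x g}

variable {L} in
/-- The preimage of `W ⊆ Sp A` under the map `Sp B → Sp A`, `y ↦ φ⁻¹(y)`, given by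
`φ : A → B`. (For affinoid algebras the preimage of a maximal ideal is a maximal ideal.) -/
def spPreimage {B : Type*} [CommRing B] [Algebra L B] (φ : A →ₐ[L] B)
    (W : Set (MaximalSpectrum A)) : Set (MaximalSpectrum B) :=
  {y | ∃ x ∈ W, x.asIdeal = y.asIdeal.comap φ}

/-- The family `𝒰` has a refinement which is a finite covering of `Sp A` by rational
subdomains. -/
def HasFiniteRationalRefinement (𝒰 : Set (Set (MaximalSpectrum A))) : Prop :=
  ∃ 𝓕 : Set (Set (MaximalSpectrum A)), 𝓕.Finite ∧ (∀ V ∈ 𝓕, IsRationalSubdomain L V) ∧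
    ⋃₀ 𝓕 = Set.univ ∧ ∀ V ∈ 𝓕, ∃ U ∈ 𝒰, V ⊆ U

/-- For every morphism of affinoid spaces `Sp B → Sp A` with image in `W`, the pull-back to
`Sp B` of the family `𝒰` is refined by a finite covering by rational subdomains. (Every affinoid
algebra has an isomorphic copy in the universe of `L`.) -/
def PullsBackToFinite (W : Set (MaximalSpectrum A)) (𝒰 : Set (Set (MaximalSpectrum A))) : Prop :=
  ∀ (B : Type u) [CommRing B] [Algebra L B], IsAffinoidAlgebra L B → ∀ φ : A →ₐ[L] B,
    spPreimage φ W = Set.univ → HasFiniteRationalRefinement L (spPreimage φ '' 𝒰)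

/-- Admissible open subsets of `Sp A` for the strong Grothendieck topology. By the theorem of
Gerritzen and Grauert (an affinoid subdomain is a finite union of rational subdomains) it makes no
difference whether rational subdomains or arbitrary affinoid subdomains are used here. -/
def IsSpOpen (W : Set (MaximalSpectrum A)) : Prop :=
  ∃ 𝒰 : Set (Set (MaximalSpectrum A)), (∀ V ∈ 𝒰, IsRationalSubdomain L V) ∧ ⋃₀ 𝒰 = W ∧
    PullsBackToFinite L W 𝒰

/-- Admissible coverings in `Sp A` for the strong Grothendieck topology. -/
def IsSpCover (W : Set (MaximalSpectrum A)) (𝒰 : Set (Set (MaximalSpectrum A))) : Prop :=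
  IsSpOpen L W ∧ (∀ V ∈ 𝒰, IsSpOpen L V) ∧ ⋃₀ 𝒰 = W ∧ PullsBackToFinite L W 𝒰

variable {L} in
/-- The homomorphism `φ : A → A'` of affinoid algebras represents `W ⊆ Sp A`: the map
`Sp A' → Sp A` has image in `W`, and is universal among morphisms of affinoid spaces to `Sp A`
with image in `W`. If `W` is an affinoid (in particular, a rational) subdomain of `Sp A`, this says
that `A'` is the `A`-algebra of sections over `W` of the structure sheaf of `Sp A`. -/
def Represents {A' : Type*} [CommRing A'] [Algebra L A'] (φ : A →ₐ[L] A')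
    (W : Set (MaximalSpectrum A)) : Prop :=
  IsAffinoidAlgebra L A' ∧ spPreimage φ W = Set.univ ∧
    ∀ (B : Type u) [CommRing B] [Algebra L B], IsAffinoidAlgebra L B → ∀ ψ : A →ₐ[L] B,
      spPreimage ψ W = Set.univ → ∃! χ : A' →ₐ[L] B, χ.comp φ = ψ

end Affinoid

/-- A Grothendieck topology on the set `X` in the sense of rigid geometry (a `G`-topology), with
the usual completeness conditions `(G₀)`, `(G₁)`, `(G₂)`. -/
structure GTopology (X : Type v) where
  /-- `U` is admissible open. -/
  IsOpen : Set X → Prop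
  /-- The family `𝒰` is an admissible covering of `U`. -/
  IsCover : Set X → Set (Set X) → Prop
  isOpen_of_isCover {U : Set X} {𝒰 : Set (Set X)} : IsCover U 𝒰 → IsOpen U
  isOpen_of_mem {U : Set X} {𝒰 : Set (Set X)} : IsCover U 𝒰 → ∀ V ∈ 𝒰, IsOpen V
  sUnion_eq {U : Set X} {𝒰 : Set (Set X)} : IsCover U 𝒰 → ⋃₀ 𝒰 = U
  inter {U V : Set X} : IsOpen U → IsOpen V → IsOpen (U ∩ V)
  cover_self {U : Set X} : IsOpen U → IsCover U {U}
  cover_inter {U V : Set X} {𝒰 : Set (Set X)} : IsCover U 𝒰 → IsOpen V → V ⊆ U →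
    IsCover V ((fun W => V ∩ W) '' 𝒰)
  cover_trans {U : Set X} {𝒰 : Set (Set X)} (𝒱 : Set X → Set (Set X)) : IsCover U 𝒰 →
    (∀ V ∈ 𝒰, IsCover V (𝒱 V)) → IsCover U (⋃ V ∈ 𝒰, 𝒱 V)
  isOpen_empty : IsOpen ∅
  isOpen_univ : IsOpen Set.univ
  isOpen_of_cover {U V : Set X} {𝒰 : Set (Set X)} : IsCover U 𝒰 → V ⊆ U →
    (∀ W ∈ 𝒰, IsOpen (V ∩ W)) → IsOpen V
  cover_of_refinement {U : Set X} {𝒰 𝒱 : Set (Set X)} : IsCover U 𝒱 →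
    (∀ V ∈ 𝒱, ∃ W ∈ 𝒰, V ⊆ W) → (∀ W ∈ 𝒰, IsOpen W) → ⋃₀ 𝒰 = U → IsCover U 𝒰

/-- The admissible open subsets. -/
abbrev GTopology.Opens {X : Type v} (G : GTopology X) : Type v := {U : Set X // G.IsOpen U}

set_option linter.checkUnivs false in
/-- A `G`-ringed space over `L`: a set with a `G`-topology and a sheaf of `L`-algebras. -/
structure GRingedSpace (L : Type u) [Field L] where
  carrier : Type v
  top : GTopology carrier
  /-- The sections `𝒪(U)` of the structure sheaf. -/
  sec : top.Opens → Type w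
  [ring : ∀ U, CommRing (sec U)]
  [algebra : ∀ U, Algebra L (sec U)]
  res {U V : top.Opens} : V.1 ⊆ U.1 → sec U →ₐ[L] sec V
  res_self {U : top.Opens} (h : U.1 ⊆ U.1) (f : sec U) : res h f = f
  res_res {U V W : top.Opens} (h : V.1 ⊆ U.1) (h' : W.1 ⊆ V.1) (f : sec U) :
    res h' (res h f) = res (h'.trans h) f
  separated {U : top.Opens} {𝒰 : Set (Set carrier)} : top.IsCover U.1 𝒰 → ∀ f g : sec U,
    (∀ (V : top.Opens) (_ : V.1 ∈ 𝒰) (h : V.1 ⊆ U.1), res h f = res h g) → f = g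
  glue {U : top.Opens} {𝒰 : Set (Set carrier)} : top.IsCover U.1 𝒰 →
    ∀ s : (V : top.Opens) → V.1 ∈ 𝒰 → sec V,
    (∀ (V V' : top.Opens) (hV : V.1 ∈ 𝒰) (hV' : V'.1 ∈ 𝒰) (W : top.Opens) (h : W.1 ⊆ V.1)
      (h' : W.1 ⊆ V'.1), res h (s V hV) = res h' (s V' hV')) →
    ∃ f : sec U, ∀ (V : top.Opens) (hV : V.1 ∈ 𝒰) (h : V.1 ⊆ U.1), res h f = s V hV

attribute [instance] GRingedSpace.ring GRingedSpace.algebra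

section Spaces

variable {L : Type u} [NontriviallyNormedField L] [IsUltrametricDist L]

/-- The admissible open `U`, with the induced `G`-topology and sheaf, is isomorphic to the affinoid
space `Sp A`, where (necessarily) `A = 𝒪(U)` is an affinoid algebra: there is a bijection
`U ≃ Sp A` which identifies admissible open subsets and admissible coverings and which identifies
the sections over each rational subdomain (these determine a sheaf). -/
def GRingedSpace.IsAffinoid (X : GRingedSpace.{u, v, w} L) (U : X.top.Opens) : Prop :=
  IsAffinoidAlgebra L (X.sec U) ∧
  ∃ e : U.1 ≃ MaximalSpectrum (X.sec U),
    (∀ W : Set (MaximalSpectrum (X.sec U)),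
      X.top.IsOpen (Subtype.val '' (e ⁻¹' W)) ↔ IsSpOpen L W) ∧
    (∀ (W : Set (MaximalSpectrum (X.sec U))) (𝒲 : Set (Set (MaximalSpectrum (X.sec U)))),
      X.top.IsCover (Subtype.val '' (e ⁻¹' W)) ((fun V => Subtype.val '' (e ⁻¹' V)) '' 𝒲) ↔
        IsSpCover L W 𝒲) ∧
    ∀ (W : Set (MaximalSpectrum (X.sec U))) (V : X.top.Opens) (h : V.1 ⊆ U.1),
      IsRationalSubdomain L W → V.1 = Subtype.val '' (e ⁻¹' W) → Represents (X.res h) W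

set_option linter.checkUnivs false in
variable (L) in
/-- A rigid analytic space over `L`: a `G`-ringed space with an admissible covering by
affinoid open subspaces. (Its stalks are then automatically local rings.) -/
structure RigidSpace extends GRingedSpace.{u, v, w} L where
  locally_affinoid : ∃ 𝒰 : Set (Set carrier), top.IsCover Set.univ 𝒰 ∧
    ∀ U : top.Opens, U.1 ∈ 𝒰 → toGRingedSpace.IsAffinoid U

/-- The dimension of a rigid analytic space: the supremum of the Krull dimensions of the affinoid
algebras `𝒪(U)`, for `U` affinoid open. It is `⊥` for the empty space. -/
noncomputable def RigidSpace.dim (X : RigidSpace.{u, v, w} L) : WithBot ℕ∞ :=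
  ⨆ U : {U : X.top.Opens // X.IsAffinoid U}, ringKrullDim (X.sec U.1)

/-- The germ of `f ∈ 𝒪(U)` at `x ∈ U` is a unit of the stalk at `x`. -/
def GRingedSpace.IsUnitAt (X : GRingedSpace.{u, v, w} L) {U : X.top.Opens} (f : X.sec U)
    (x : X.carrier) : Prop :=
  ∃ (V : X.top.Opens) (h : V.1 ⊆ U.1), x ∈ V.1 ∧ IsUnit (X.res h f)

/-- Morphisms of rigid analytic spaces over `L`, i.e. of locally `G`-ringed spaces over `L`. -/
structure RigidSpace.Hom (Y : RigidSpace.{u, v, w} L) (X : RigidSpace.{u, v', w'} L) where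
  toFun : Y.carrier → X.carrier
  isOpen_preimage {U : Set X.carrier} : X.top.IsOpen U → Y.top.IsOpen (toFun ⁻¹' U)
  isCover_preimage {U : Set X.carrier} {𝒰 : Set (Set X.carrier)} : X.top.IsCover U 𝒰 →
    Y.top.IsCover (toFun ⁻¹' U) (Set.preimage toFun '' 𝒰)
  /-- The homomorphisms `𝒪_X(U) → 𝒪_Y(f⁻¹(U))`. -/
  comap (U : X.top.Opens) : X.sec U →ₐ[L] Y.sec ⟨toFun ⁻¹' U.1, isOpen_preimage U.2⟩
  comap_res {U V : X.top.Opens} (h : V.1 ⊆ U.1) (f : X.sec U) :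
    comap V (X.res h f) = Y.res (fun _ hy => h hy) (comap U f)
  isLocal (U : X.top.Opens) (f : X.sec U) (y : Y.carrier) : toFun y ∈ U.1 →
    Y.IsUnitAt (comap U f) y → X.IsUnitAt f (toFun y)

/-- Closed immersions, i.e. Zariski-closed analytic subspaces: locally on an admissible affinoid
covering of the target, of the form `Sp B → Sp A` with `A → B` surjective. -/
def RigidSpace.Hom.IsClosedImmersion {Y : RigidSpace.{u, v, w} L} {X : RigidSpace.{u, v', w'} L}
    (i : Y.Hom X) : Prop :=
  ∃ 𝒰 : Set (Set X.carrier), X.top.IsCover Set.univ 𝒰 ∧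
    ∀ U : X.top.Opens, U.1 ∈ 𝒰 →
      X.IsAffinoid U ∧ Y.IsAffinoid ⟨i.toFun ⁻¹' U.1, i.isOpen_preimage U.2⟩ ∧
        Function.Surjective (i.comap U)

end Spaces

end Rigid

/-! The problem is moved to one affinoid chart. As `n` is finite, some affinoid open `U` has `dim
𝒪(U) ≥ n`. For each `j`, the covering witnessing the closed immersion is refined on `U` by finitely
many rational subdomains `W`, each inside some member `V`. Over `W` the points of `Y_j` come from
maximal ideals of `C = 𝒪(W) / I𝒪(W)`, where `I` is the kernel of `𝒪(V) → 𝒪(Y_j ∩ V)`. Since `Sp 𝒪(W)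
→ Sp 𝒪(V)` is injective, its fibres have dimension zero and `dim C ≤ dim Y_j`
(`ringKrullDim_quotient_map_ker_le`).

It remains to see that countably many Noetherian algebras `C` of dimension `< n` over `A = 𝒪(U)`
miss a maximal ideal of `A` (`exists_maximalSpectrum_ne_comap`). For `n ≥ 1`, fix a maximal `m` of
height `≥ n` and cut by `n - 1` elements of `m`, generic with respect to every `C`; this is possible
because `L` is uncountable. A minimal prime `P ≤ m` over the cut differs from `m`, while away from
`m` each `C` reaches only finitely many maximal ideals containing `P`. If all points were reached,
`A / P` would have countably many maximal ideals without being a field, contrary to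
`IsAffinoidAlgebra.isField_of_countable`.

The facts about affinoid algebras come from the image `B` of the unit ball of a Tate algebra: it is
Noetherian, `p` lies in all its maximal ideals, `B / p` is of finite type over `ℤ`, and `A =
B[1/p]`. By Krull's principal ideal theorem, if `B` is a domain, an element of a maximal ideal of
`B` lying in no minimal prime over `p` lies in a prime without `p`, so it is not a unit of `A`. This
gives both the Nullstellensatz and the uncountability of maximal spectra. -/

namespace Rigid

universe u v w v' w'

/-! ### Commutative algebra: adic completeness, generic linear combinations, principal ideal
theorem. -/

section CommAlg

/-- Successive approximation: generators of `M / aM` generate `M` if the base ring is `a`-adically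
complete and `M` is `a`-adically separated. -/
theorem exists_sum_smul_of_isPrecomplete {R M ι : Type*} [CommRing R] [AddCommGroup M] [Module R M]
    [Fintype ι] (a : R) [IsPrecomplete (Ideal.span {a}) R]
    (haus : ∀ x : M, (∀ n : ℕ, ∃ y : M, x = a ^ n • y) → x = 0) (v : ι → M)
    (h : ∀ x : M, ∃ (c : ι → R) (y : M), x = ∑ i, c i • v i + a • y) (x : M) :
    ∃ c : ι → R, x = ∑ i, c i • v i := by
  choose c y hcy using h
  let s : ℕ → M := fun n => y^[n] x
  have hs : ∀ n, s n = ∑ i, c (s n) i • v i + a • s (n + 1) := fun n => by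
    simp only [s, Function.iterate_succ_apply']
    exact hcy _
  let S : ι → ℕ → R := fun i n => ∑ k ∈ Finset.range n, a ^ k * c (s k) i
  have hS : ∀ n, x = ∑ i, S i n • v i + a ^ n • s n := by
    intro n
    induction n with
    | zero => simp [S, s]
    | succ n ih =>
      conv_lhs => rw [ih, hs n]
      simp only [S, Finset.sum_range_succ, add_smul, Finset.sum_add_distrib, smul_add, smul_smul,
        Finset.smul_sum, pow_succ]
      abel
  have hmod : ∀ i, ∃ l : R, ∀ n, S i n ≡ l [SMOD (Ideal.span {a} ^ n • ⊤ : Submodule R R)] := by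
    intro i
    refine IsPrecomplete.prec' (S i) fun {m n} hmn => ?_
    rw [SModEq.sub_mem, smul_eq_mul, Ideal.mul_top, Ideal.span_singleton_pow,
      Ideal.mem_span_singleton, ← neg_sub, dvd_neg]
    simp only [S]
    rw [← Finset.sum_range_add_sum_Ico _ hmn, add_sub_cancel_left]
    exact Finset.dvd_sum fun k hk => (pow_dvd_pow a (Finset.mem_Ico.1 hk).1).mul_right _
  choose l hl using hmod
  refine ⟨l, sub_eq_zero.1 (haus _ fun n => ?_)⟩
  have : ∀ i, ∃ d : R, S i n - l i = a ^ n * d := fun i => by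
    have := hl i n
    rwa [SModEq.sub_mem, smul_eq_mul, Ideal.mul_top, Ideal.span_singleton_pow,
      Ideal.mem_span_singleton] at this
  choose d hd using this
  refine ⟨∑ i, d i • v i + s n, ?_⟩
  conv_lhs => rw [hS n]
  rw [smul_add, Finset.smul_sum, add_sub_right_comm, ← Finset.sum_sub_distrib]
  simp only [smul_smul, ← hd, sub_smul]

/-- By Cohen's theorem only primes `P` matter. Generators of the image of `P` modulo `a` are lifted
to `P`. If `a ∈ P`, adjoining `a` suffices. Otherwise `P ∩ aR = aP`, so the lifts generate `P`
modulo `aP` and successive approximation applies. -/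
theorem isNoetherianRing_of_isAdicComplete {R : Type*} [CommRing R] (a : R)
    [IsAdicComplete (Ideal.span {a}) R] [IsNoetherianRing (R ⧸ Ideal.span {a})] :
    IsNoetherianRing R := by
  classical
  refine IsNoetherianRing.of_prime fun P hP => ?_
  obtain ⟨t, ht⟩ : ((P.map (Ideal.Quotient.mk (Ideal.span {a})))).FG := IsNoetherian.noetherian _
  change Submodule.span _ _ = _ at ht
  have htm : ∀ z : t, ∃ x : P, Ideal.Quotient.mk (Ideal.span {a}) x = z := fun z => by
    have hz : (z : R ⧸ Ideal.span {a}) ∈ P.map (Ideal.Quotient.mk (Ideal.span {a})) :=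
      ht ▸ Submodule.subset_span z.2
    obtain ⟨x, hx, hxz⟩ := (Ideal.mem_map_iff_of_surjective _ Ideal.Quotient.mk_surjective).1 hz
    exact ⟨⟨x, hx⟩, hxz⟩
  choose v hv using htm
  have hgen : ∀ x : P, ∃ (d : t → R) (y : R), (x : R) = ∑ i, d i * v i + a * y := fun x => by
    have hx : Ideal.Quotient.mk (Ideal.span {a}) x ∈
        Submodule.span (R ⧸ Ideal.span {a}) (t : Set _) := by
      rw [ht]; exact Ideal.mem_map_of_mem _ x.2
    obtain ⟨c, hc⟩ := (Submodule.mem_span_finset').1 hx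
    choose d hd using fun i => Ideal.Quotient.mk_surjective (I := Ideal.span {a}) (c i)
    have h0 : Ideal.Quotient.mk (Ideal.span {a}) ((x : R) - ∑ i, d i * v i) = 0 := by
      rw [map_sub, map_sum, ← hc]
      simp [hd, hv]
    obtain ⟨y, hy⟩ := Ideal.mem_span_singleton.1 (Ideal.Quotient.eq_zero_iff_mem.1 h0)
    exact ⟨d, y, by rw [← hy]; ring⟩
  by_cases ha : a ∈ P
  · refine ⟨insert a (Finset.univ.image fun i => (v i : R)), le_antisymm ?_ fun x hx => ?_⟩
    · rw [Ideal.span_le]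
      intro z hz
      obtain rfl | hz := Finset.mem_insert.1 (Finset.mem_coe.1 hz)
      · exact ha
      · obtain ⟨i, -, rfl⟩ := Finset.mem_image.1 hz
        exact (v i).2
    · obtain ⟨d, y, h⟩ := hgen ⟨x, hx⟩
      rw [show x = _ from h]
      exact add_mem (sum_mem fun i _ => Ideal.mul_mem_left _ _ (Ideal.subset_span (by simp)))
        (Ideal.mul_mem_right _ _ (Ideal.subset_span (by simp)))
  · have key := exists_sum_smul_of_isPrecomplete (M := P) a (fun x hx => by
      refine Subtype.ext (IsHausdorff.haus (I := Ideal.span {a}) inferInstance _ fun n => ?_)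
      obtain ⟨y, rfl⟩ := hx n
      rw [SModEq.zero, smul_eq_mul, Ideal.mul_top, Ideal.span_singleton_pow,
        Ideal.mem_span_singleton]
      simp) v (fun x => by
      obtain ⟨d, y, hy⟩ := hgen x
      have hyP : y ∈ P := by
        refine (hP.mem_or_mem (x := a) (y := y) ?_).resolve_left ha
        rw [← sub_eq_iff_eq_add'.2 hy]
        exact sub_mem x.2 (sum_mem fun i _ => P.mul_mem_left _ (v i).2)
      refine ⟨d, ⟨y, hyP⟩, Subtype.ext ?_⟩
      simp [hy])
    refine ⟨Finset.univ.image fun i => (v i : R), le_antisymm ?_ fun x hx => ?_⟩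
    · rw [Ideal.span_le]
      intro z hz
      obtain ⟨i, -, rfl⟩ := Finset.mem_image.1 (Finset.mem_coe.1 hz)
      exact (v i).2
    · obtain ⟨c, hc⟩ := key ⟨x, hx⟩
      rw [show x = _ from congrArg Subtype.val hc]
      simp only [Submodule.coe_sum, Submodule.coe_smul]
      exact sum_mem fun i _ => Ideal.mul_mem_left _ _ (Ideal.subset_span (by simp))

/-- A linear combination with coefficients the powers of some `c` in a given uncountable set avoids
countably many subspaces none of which contains all the given vectors. -/
theorem exists_sum_pow_smul_notMem {K V ι : Type*} [Field K] [AddCommGroup V] [Module K V]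
    [Countable ι] (S : Set K) (hS : ¬ S.Countable) {r : ℕ} (v : Fin r → V)
    (q : ι → Submodule K V) (hq : ∀ i, ∃ s, v s ∉ q i) :
    ∃ c ∈ S, ∀ i, ∑ s : Fin r, c ^ (s : ℕ) • v s ∉ q i := by
  by_contra! hcon
  choose s hs using hq
  have hl : ∀ i, ∃ l : V →ₗ[K] K, l (v (s i)) ≠ 0 ∧ ∀ x ∈ q i, l x = 0 := fun i => by
    obtain ⟨l, h1, h2⟩ := Submodule.exists_le_ker_of_notMem (hs i)
    exact ⟨l, h1, fun x hx => h2 hx⟩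
  choose l hl1 hl2 using hl
  -- The functional `l i` takes the value `(P i)(c)` on the combination, so the bad `c` for `i` are
  -- roots of a nonzero polynomial.
  let P : ι → Polynomial K := fun i => ∑ s : Fin r, Polynomial.monomial (s : ℕ) (l i (v s))
  have hP : ∀ i, P i ≠ 0 := fun i h => hl1 i <| by
    have := congrArg (Polynomial.coeff · (s i : ℕ)) h
    simpa [P, Polynomial.finsetSum_coeff, Polynomial.coeff_monomial, Fin.val_inj] using this
  refine hS ((Set.countable_iUnion fun i => ((P i).rootSet_finite K).countable).mono
    fun c hc => ?_)
  obtain ⟨i, hi⟩ := hcon c hc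
  refine Set.mem_iUnion.2 ⟨i, Polynomial.mem_rootSet.2 ⟨hP i, ?_⟩⟩
  have := hl2 i _ hi
  simpa [P, Polynomial.eval_finsetSum, mul_comm] using this

/-- Under a prime `M` which contains `a` but is not minimal over it, there is a prime through `g`
avoiding `a`. -/
theorem exists_prime_le_notMem {R : Type*} [CommRing R] [IsDomain R] [IsNoetherianRing R]
    {a g : R} (ha : a ≠ 0) {M : Ideal R} [M.IsPrime] (hg : g ∈ M)
    (hmin : ∀ q ∈ (Ideal.span {a}).minimalPrimes, g ∉ q) :
    ∃ Q : Ideal R, Q.IsPrime ∧ Q ≤ M ∧ g ∈ Q ∧ a ∉ Q := by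
  obtain ⟨Q, hQ, hQM⟩ := Ideal.exists_minimalPrimes_le
    (I := Ideal.span {g}) (J := M) ((Ideal.span_singleton_le_iff_mem _).2 hg)
  have hQp : Q.IsPrime := hQ.1.1
  have hgQ : g ∈ Q := hQ.1.2 (Ideal.mem_span_singleton_self g)
  refine ⟨Q, hQp, hQM, hgQ, fun haQ => ?_⟩
  have hht : Q.height ≤ 1 :=
    Ideal.height_le_one_of_isPrincipal_of_mem_minimalPrimes (Ideal.span {g}) Q hQ
  obtain ⟨q, hq, hqQ⟩ := Ideal.exists_minimalPrimes_le
    (I := Ideal.span {a}) (J := Q) ((Ideal.span_singleton_le_iff_mem _).2 haQ)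
  have hqp : q.IsPrime := hq.1.1
  -- If `a ∈ Q`, the chain `⊥ < q < Q` gives height at least 2, against the principal ideal theorem.
  have hlt : q < Q := lt_of_le_of_ne hqQ fun h => hmin q hq (h ▸ hgQ)
  have h0 : q ≠ ⊥ := fun h => ha (by
    have := hq.1.2 (Ideal.mem_span_singleton_self a); rwa [h, Ideal.mem_bot] at this)
  have h1 := Ideal.height_add_one_le_of_lt_of_isPrime hlt
  have h2 := Ideal.height_add_one_le_of_lt_of_isPrime (bot_lt_iff_ne_bot.2 h0)
  have h3 : (1 : ℕ∞) + 1 ≤ 1 :=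
    (add_le_add_left (le_trans (by simp) h2) 1).trans (h1.trans hht)
  exact absurd h3 (by norm_num)

/-- A prime which is not minimal over `a` is not covered by the minimal primes over `a`. -/
theorem exists_mem_forall_minimalPrimes_notMem {R : Type*} [CommRing R] [IsNoetherianRing R]
    (a : R) {M : Ideal R} [hM : M.IsPrime] (h : M ∉ (Ideal.span {a}).minimalPrimes)
    (ha : a ∈ M) : ∃ g ∈ M, ∀ q ∈ (Ideal.span {a}).minimalPrimes, g ∉ q := by
  by_contra! hcon
  have hfin := (Ideal.span {a}).finite_minimalPrimes_of_isNoetherianRing R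
  have hsub : (M : Set R) ⊆ ⋃ i ∈ (↑hfin.toFinset : Set (Ideal R)), (i : Set R) := fun g hg => by
    obtain ⟨q, hq, hgq⟩ := hcon g hg
    simp only [Set.mem_iUnion]
    exact ⟨q, by simpa using hq, hgq⟩
  obtain ⟨q, hq, hMq⟩ := (Ideal.subset_union_prime (f := fun i : Ideal R => i) ⊥ ⊥
    (fun i hi _ _ => (hfin.mem_toFinset.1 hi).1.1)).1 hsub
  have hq := hfin.mem_toFinset.1 hq
  have : q = M := le_antisymm (hq.2 ⟨hM, (Ideal.span_singleton_le_iff_mem _).2 ha⟩ hMq) hMq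
  exact h (this ▸ hq)

end CommAlg

/-! ### The unit ball of the Tate algebra is `p`-adically complete and Noetherian. -/

section Tate

theorem norm_natCast_prime (L : Type*) [NontriviallyNormedField L] (p : ℕ) [Fact p.Prime]
    [NormedAlgebra ℚ_[p] L] : ‖(p : L)‖ = (p : ℝ)⁻¹ := by
  rw [← map_natCast (algebraMap ℚ_[p] L), norm_algebraMap', Padic.norm_p]

theorem norm_natCast_prime_pos (L : Type*) [NontriviallyNormedField L] (p : ℕ) [Fact p.Prime]
    [NormedAlgebra ℚ_[p] L] : 0 < ‖(p : L)‖ := by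
  rw [norm_natCast_prime L p]
  exact inv_pos.2 (Nat.cast_pos.2 (Fact.out : p.Prime).pos)

theorem natCast_prime_ne_zero (L : Type*) [NontriviallyNormedField L] (p : ℕ) [Fact p.Prime]
    [NormedAlgebra ℚ_[p] L] : (p : L) ≠ 0 := norm_pos_iff.1 (norm_natCast_prime_pos L p)

theorem norm_natCast_prime_lt_one (L : Type*) [NontriviallyNormedField L] (p : ℕ) [Fact p.Prime]
    [NormedAlgebra ℚ_[p] L] : ‖(p : L)‖ < 1 := by
  rw [norm_natCast_prime L p]
  exact inv_lt_one_of_one_lt₀ (by exact_mod_cast (Fact.out : p.Prime).one_lt)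

open Filter Topology

/-- The unit ball of `L` modulo `p` is finite. -/
theorem exists_finite_approx (L : Type*) [NontriviallyNormedField L] (p : ℕ) [Fact p.Prime]
    [NormedAlgebra ℚ_[p] L] [FiniteDimensional ℚ_[p] L] : ∃ F : Set L, F.Finite ∧ (∀ b ∈ F, ‖b‖ ≤ 1) ∧
    ∀ a : L, ‖a‖ ≤ 1 → ∃ b ∈ F, ‖a - b‖ ≤ ‖(p : L)‖ := by
  have := FiniteDimensional.proper ℚ_[p] L
  obtain ⟨F, hF1, hF2, hF3⟩ := Metric.finite_approx_of_totallyBounded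
    (isCompact_closedBall (0 : L) 1).totallyBounded _ (norm_natCast_prime_pos L p)
  refine ⟨F, hF2, fun b hb => by simpa using hF1 hb, fun a ha => ?_⟩
  have := hF3 (show a ∈ Metric.closedBall (0 : L) 1 by simpa using ha)
  simp only [Set.mem_iUnion, Metric.mem_ball, dist_eq_norm] at this
  obtain ⟨b, hb, h⟩ := this
  exact ⟨b, hb, h.le⟩

theorem mem_tateAlgebra_iff {L : Type*} [NontriviallyNormedField L] [IsUltrametricDist L] {m : ℕ}
    {f : MvPowerSeries (Fin m) L} :
    f ∈ tateAlgebra L m ↔ ∀ ε > 0, {t | ε ≤ ‖MvPowerSeries.coeff t f‖}.Finite := by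
  change Tendsto _ _ _ ↔ _
  simp only [one_pow, Finsupp.prod, Finset.prod_const_one, mul_one]
  rw [Metric.tendsto_nhds]
  simp [Filter.eventually_cofinite]

/-- The power series with coefficients in the unit ball in the Tate algebra. -/
def tateBall (L : Type*) [NontriviallyNormedField L] [IsUltrametricDist L] (m : ℕ) :
    Subring (tateAlgebra L m) where
  carrier := {f | ∀ t, ‖MvPowerSeries.coeff t f.1‖ ≤ 1}
  zero_mem' t := by simp
  one_mem' t := by
    classical
    simp only [OneMemClass.coe_one, MvPowerSeries.coeff_one]
    split_ifs <;> simp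
  add_mem' {f g} hf hg t := (IsUltrametricDist.norm_add_le_max _ _).trans (max_le (hf t) (hg t))
  neg_mem' {f} hf t := by simpa using hf t
  mul_mem' {f g} hf hg t := by
    classical
    simp only [MulMemClass.coe_mul, MvPowerSeries.coeff_mul]
    refine IsUltrametricDist.norm_sum_le_of_forall_le_of_nonneg zero_le_one fun x _ => ?_
    rw [norm_mul]
    exact mul_le_one₀ (hf _) (norm_nonneg _) (hg _)

variable {L : Type*} [NontriviallyNormedField L] [IsUltrametricDist L] {m : ℕ}

/-- The coefficients of an element of the unit ball of the Tate algebra. -/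
def ballCoeff (t : Fin m →₀ ℕ) : tateBall L m →+ L where
  toFun f := MvPowerSeries.coeff t f.1.1
  map_zero' := by simp
  map_add' f g := by simp

theorem norm_ballCoeff_le (t : Fin m →₀ ℕ) (f : tateBall L m) : ‖ballCoeff t f‖ ≤ 1 := f.2 t

theorem ballCoeff_ext {f g : tateBall L m} (h : ∀ t, ballCoeff t f = ballCoeff t g) : f = g :=
  Subtype.ext (Subtype.ext (MvPowerSeries.ext h))

theorem ballCoeff_natCast_mul (t : Fin m →₀ ℕ) (k : ℕ) (f : tateBall L m) :
    ballCoeff t ((k : tateBall L m) * f) = k * ballCoeff t f := by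
  rw [← nsmul_eq_mul, map_nsmul, nsmul_eq_mul]

theorem finite_le_norm_ballCoeff (f : tateBall L m) {ε : ℝ} (hε : 0 < ε) :
    {t | ε ≤ ‖ballCoeff t f‖}.Finite := mem_tateAlgebra_iff.1 f.1.2 ε hε

/-- The element of the unit ball of the Tate algebra with given coefficients. -/
def ballMk (c : (Fin m →₀ ℕ) → L) (hc : ∀ t, ‖c t‖ ≤ 1)
    (hfin : ∀ ε > 0, {t | ε ≤ ‖c t‖}.Finite) : tateBall L m :=
  ⟨⟨c, mem_tateAlgebra_iff.2 hfin⟩, hc⟩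

theorem ballCoeff_ballMk (c : (Fin m →₀ ℕ) → L) (hc : ∀ t, ‖c t‖ ≤ 1)
    (hfin : ∀ ε > 0, {t | ε ≤ ‖c t‖}.Finite) (t : Fin m →₀ ℕ) :
    ballCoeff t (ballMk c hc hfin) = c t := rfl

theorem exists_natCast_mul_eq {k : ℕ} (hk : (k : L) ≠ 0) {f : tateBall L m}
    (hf : ∀ t, ‖ballCoeff t f‖ ≤ ‖(k : L)‖) : ∃ g : tateBall L m, f = k * g := by
  have hk' : 0 < ‖(k : L)‖ := norm_pos_iff.2 hk
  refine ⟨ballMk (fun t => (k : L)⁻¹ * ballCoeff t f) (fun t => ?_) (fun ε hε => ?_),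
    ballCoeff_ext fun t => ?_⟩
  · rw [norm_mul, norm_inv, inv_mul_le_iff₀ hk', mul_one]
    exact hf t
  · refine (finite_le_norm_ballCoeff f (mul_pos hk' hε)).subset fun t ht => ?_
    simp only [Set.mem_ofPred_eq, norm_mul, norm_inv] at ht ⊢
    rwa [← le_inv_mul_iff₀ hk']
  · rw [ballCoeff_natCast_mul, ballCoeff_ballMk, mul_inv_cancel_left₀ hk]

/-- Monomials. -/
noncomputable def ballMonomial (t : Fin m →₀ ℕ) (a : L) (ha : ‖a‖ ≤ 1) : tateBall L m :=
  ⟨⟨MvPowerSeries.monomial t a,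
    MvPowerSeries.isRestricted_monomial (fun _ : Fin m => (1 : ℝ)) t a⟩, fun s => by
    classical
    simp only [MvPowerSeries.coeff_monomial]
    split_ifs <;> simp [ha]⟩

theorem ballCoeff_ballMonomial (s t : Fin m →₀ ℕ) (a : L)
    (ha : ‖a‖ ≤ 1) : ballCoeff s (ballMonomial t a ha) = if s = t then a else 0 :=
  MvPowerSeries.coeff_monomial s t a

theorem ballMonomial_mul (s t : Fin m →₀ ℕ) (a b : L) (ha : ‖a‖ ≤ 1) (hb : ‖b‖ ≤ 1) :
    ballMonomial s a ha * ballMonomial t b hb = ballMonomial (s + t) (a * b)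
      (by rw [norm_mul]; exact mul_le_one₀ ha (norm_nonneg _) hb) :=
  Subtype.ext (Subtype.ext (MvPowerSeries.monomial_mul_monomial s t a b))

theorem ballMonomial_zero_one : ballMonomial (m := m) 0 (1 : L) norm_one.le = 1 := rfl

variable (L) in
theorem ballMonomial_one_mem_closure (t : Fin m →₀ ℕ) :
    ballMonomial t (1 : L) norm_one.le ∈
      Subring.closure (Set.range fun i : Fin m =>
        ballMonomial (Finsupp.single i 1) (1 : L) norm_one.le) := by
  induction t using Finsupp.induction_linear with
  | zero =>
    rw [ballMonomial_zero_one]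
    exact one_mem _
  | add s t hs ht =>
    have := mul_mem hs ht
    rw [ballMonomial_mul] at this
    simpa using this
  | single i n =>
    induction n with
    | zero =>
      simp only [Finsupp.single_zero, ballMonomial_zero_one]
      exact one_mem _
    | succ n ih =>
      have := mul_mem ih (Subring.subset_closure (Set.mem_range_self i))
      rw [ballMonomial_mul] at this
      simpa [← Finsupp.single_add] using this

theorem norm_ballCoeff_sub_le_of_smodEq {p n : ℕ} {f g : tateBall L m}
    (h : f ≡ g [SMOD (Ideal.span {(p : tateBall L m)} ^ n • ⊤ :
      Submodule (tateBall L m) (tateBall L m))])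
    (t : Fin m →₀ ℕ) : ‖ballCoeff t f - ballCoeff t g‖ ≤ ‖(p : L)‖ ^ n := by
  rw [SModEq.sub_mem, smul_eq_mul, Ideal.mul_top, Ideal.span_singleton_pow,
    Ideal.mem_span_singleton] at h
  obtain ⟨y, hy⟩ := h
  rw [← map_sub, hy, ← Nat.cast_pow, ballCoeff_natCast_mul, norm_mul, Nat.cast_pow, norm_pow]
  exact mul_le_of_le_one_right (by positivity) (norm_ballCoeff_le _ _)

variable {p : ℕ} [Fact p.Prime] [NormedAlgebra ℚ_[p] L]

variable [FiniteDimensional ℚ_[p] L]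

variable (L p m) in
-- All but finitely many coefficients of `f` are smaller than `p`. The others are replaced by
-- representatives from a finite set, so modulo `p` every `f` is a polynomial with coefficients in
-- that set.
theorem exists_finite_closure_add : ∃ G : Set (tateBall L m), G.Finite ∧
    ∀ f : tateBall L m, ∃ s ∈ Subring.closure G, ∃ y, f = s + p * y := by
  classical
  obtain ⟨F, hF, hF1, hFa⟩ := exists_finite_approx L p
  have := hF.to_subtype
  let G : Set (tateBall L m) := Set.range (fun b : F => ballMonomial 0 b.1 (hF1 b b.2)) ∪
    Set.range fun i : Fin m => ballMonomial (Finsupp.single i 1) (1 : L) norm_one.le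
  have hmon : ∀ (b : L) (hb : b ∈ F) (t : Fin m →₀ ℕ),
      ballMonomial t b (hF1 b hb) ∈ Subring.closure G := fun b hb t => by
    have h1 : ballMonomial (m := m) 0 b (hF1 b hb) ∈ Subring.closure G :=
      Subring.subset_closure (Or.inl ⟨⟨b, hb⟩, rfl⟩)
    have := mul_mem h1 (Subring.closure_mono Set.subset_union_right
      (ballMonomial_one_mem_closure L t))
    rw [ballMonomial_mul] at this
    simpa using this
  refine ⟨G, (Set.finite_range _).union (Set.finite_range _), fun f => ?_⟩
  have hfin := finite_le_norm_ballCoeff f (norm_natCast_prime_pos L p)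
  choose b hbF hb using fun t => hFa (ballCoeff t f) (norm_ballCoeff_le t f)
  let s := ∑ t ∈ hfin.toFinset, ballMonomial t (b t) (hF1 _ (hbF t))
  have hs : ∀ t, ballCoeff t s = if ‖(p : L)‖ ≤ ‖ballCoeff t f‖ then b t else 0 := fun t => by
    simp only [s, map_sum, ballCoeff_ballMonomial, Finset.sum_ite_eq, Set.Finite.mem_toFinset,
      Set.mem_ofPred_eq]
  obtain ⟨y, hy⟩ := exists_natCast_mul_eq (natCast_prime_ne_zero L p) (f := f - s) fun t => by
    rw [map_sub, hs]
    split_ifs with h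
    · exact hb t
    · simpa using (not_le.1 h).le
  exact ⟨s, sum_mem fun t _ => hmon _ (hbF t) t, y, by rw [← hy]; ring⟩

variable (L p m) in
theorem finiteType_tateBall_quotient :
    Algebra.FiniteType ℤ (tateBall L m ⧸ Ideal.span {(p : tateBall L m)}) := by
  obtain ⟨G, hG, h⟩ := exists_finite_closure_add L m p
  have : Algebra.FiniteType ℤ (Algebra.adjoin ℤ G) :=
    (Subalgebra.fg_iff_finiteType _).1 ⟨hG.toFinset, by simp⟩
  refine Algebra.FiniteType.of_surjective
    ((Ideal.Quotient.mkₐ ℤ _).comp (Algebra.adjoin ℤ G).val) fun x => ?_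
  obtain ⟨f, rfl⟩ := Ideal.Quotient.mk_surjective x
  obtain ⟨s, hs, y, rfl⟩ := h f
  refine ⟨⟨s, ?_⟩, ?_⟩
  · have : Subring.closure G ≤ (Algebra.adjoin ℤ G).toSubring :=
      Subring.closure_le.2 Algebra.subset_adjoin
    exact this hs
  · refine (Ideal.Quotient.eq.2 (Ideal.mem_span_singleton.2 ⟨-y, ?_⟩))
    simp

/-- Congruence modulo `p ^ n` means that coefficients differ by at most `‖p‖ ^ n`. Limits are
therefore taken coefficientwise in the complete field `L`, and the bound is uniform in the index, so
the limit series is again restricted. -/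
instance isAdicComplete_tateBall :
    IsAdicComplete (Ideal.span {(p : tateBall L m)}) (tateBall L m) where
  haus' f hf := ballCoeff_ext fun t => by
    have h := fun n => norm_ballCoeff_sub_le_of_smodEq (hf n) t
    rw [← sub_eq_zero, ← norm_le_zero_iff]
    exact ge_of_tendsto' (tendsto_pow_atTop_nhds_zero_of_lt_one (norm_nonneg _)
      (norm_natCast_prime_lt_one L p)) h
  prec' f hf := by
    have := FiniteDimensional.complete ℚ_[p] L
    have hlim := tendsto_pow_atTop_nhds_zero_of_lt_one (norm_nonneg _)
      (norm_natCast_prime_lt_one L p)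
    have h : ∀ (t : Fin m →₀ ℕ) (k n : ℕ), k ≤ n →
        ‖ballCoeff t (f k) - ballCoeff t (f n)‖ ≤ ‖(p : L)‖ ^ k :=
      fun t k n hkn => norm_ballCoeff_sub_le_of_smodEq (hf hkn) t
    have hc : ∀ t : Fin m →₀ ℕ, ∃ l, Tendsto (fun n => ballCoeff t (f n)) atTop (𝓝 l) := fun t =>
      cauchySeq_tendsto_of_complete <| cauchySeq_of_le_geometric _ 1
        (norm_natCast_prime_lt_one L p) fun n => by
          rw [dist_eq_norm, one_mul]
          exact h t n (n + 1) n.le_succ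
    choose l hl using hc
    have hl' : ∀ t n, ‖ballCoeff t (f n) - l t‖ ≤ ‖(p : L)‖ ^ n := fun t n =>
      le_of_tendsto (((tendsto_const_nhds).sub (hl t)).norm)
        (eventually_atTop.2 ⟨n, fun k hk => h t n k hk⟩)
    have hl1 : ∀ t, ‖l t‖ ≤ 1 := fun t =>
      le_of_tendsto' (hl t).norm fun n => norm_ballCoeff_le _ _
    have hfin : ∀ ε > 0, {t | ε ≤ ‖l t‖}.Finite := fun ε hε => by
      obtain ⟨n, hn⟩ := (hlim.eventually (gt_mem_nhds hε)).exists
      refine (finite_le_norm_ballCoeff (f n) hε).subset fun t ht => ?_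
      by_contra hlt
      have h1 := IsUltrametricDist.norm_add_le_max (ballCoeff t (f n)) (l t - ballCoeff t (f n))
      rw [add_sub_cancel, norm_sub_rev] at h1
      exact absurd (ht.trans h1) (not_le.2 (max_lt (not_le.1 hlt) ((hl' t n).trans_lt hn)))
    refine ⟨ballMk l hl1 hfin, fun n => ?_⟩
    rw [SModEq.sub_mem, smul_eq_mul, Ideal.mul_top, Ideal.span_singleton_pow,
      Ideal.mem_span_singleton]
    obtain ⟨y, hy⟩ := exists_natCast_mul_eq (k := p ^ n) (f := f n - ballMk l hl1 hfin)
      (by exact_mod_cast pow_ne_zero n (natCast_prime_ne_zero L p)) fun t => by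
        rw [map_sub, ballCoeff_ballMk, Nat.cast_pow, norm_pow]
        exact hl' t n
    exact ⟨y, by simpa using hy⟩

theorem isNoetherianRing_tateBall (L : Type*) [NontriviallyNormedField L] [IsUltrametricDist L]
    (p : ℕ) [Fact p.Prime] [NormedAlgebra ℚ_[p] L] [FiniteDimensional ℚ_[p] L] (m : ℕ) :
    IsNoetherianRing (tateBall L m) := by
  have := finiteType_tateBall_quotient L m p
  have : IsNoetherianRing (tateBall L m ⧸ Ideal.span {(p : tateBall L m)}) :=
    Algebra.FiniteType.isNoetherianRing ℤ _
  exact isNoetherianRing_of_isAdicComplete (p : tateBall L m)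

end Tate

/-! ### Integral models, the Nullstellensatz, and uncountability of maximal spectra. -/

section AffinoidAlgebra

theorem isJacobsonRing_int : IsJacobsonRing ℤ := by
  refine isJacobsonRing_iff_prime_eq.2 fun P hP => le_antisymm (fun x hx => ?_) Ideal.le_jacobson
  by_cases h : P = ⊥
  · subst h
    obtain ⟨q, hq, hqp⟩ := Nat.exists_infinite_primes (x.natAbs + 1)
    have hmax : (Ideal.span {(q : ℤ)}).IsMaximal :=
      PrincipalIdealRing.isMaximal_of_irreducible (Nat.prime_iff_prime_int.1 hqp).irreducible
    have h1 := Ideal.mem_sInf.1 hx ⟨bot_le, hmax⟩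
    rw [Ideal.mem_bot]
    refine Int.eq_zero_of_abs_lt_dvd (Ideal.mem_span_singleton.1 h1) ?_
    rw [Int.abs_eq_natAbs]
    exact_mod_cast hq
  · exact Ideal.mem_sInf.1 hx ⟨le_rfl, hP.isMaximal h⟩

/-- An inverse of `g` lies in `B` after multiplication by some `p ^ k`, which would force `p ^ k ∈
Q`. -/
theorem not_isUnit_of_mem_prime {A : Type*} [CommRing A] {p : ℕ} {B : Subring A} (hk : ∀ a : A, ∃ k : ℕ, (p : A) ^ k * a ∈ B)
    {Q : Ideal B} [hQ : Q.IsPrime] (hp : (p : B) ∉ Q) {g : B} (hg : g ∈ Q) : ¬ IsUnit (g : A) := by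
  intro h
  obtain ⟨a, ha⟩ := h.exists_right_inv
  obtain ⟨k, h⟩ := hk a
  refine hp (hQ.mem_of_pow_mem k ?_)
  have : (p : B) ^ k = g * ⟨_, h⟩ := Subtype.ext (by
    push_cast
    rw [mul_left_comm, ha, mul_one])
  rw [this]
  exact Q.mul_mem_right _ hg

variable {p : ℕ} [Fact p.Prime] {L : Type*} [NontriviallyNormedField L] [IsUltrametricDist L]
  [NormedAlgebra ℚ_[p] L]
  {A : Type*} [CommRing A] [Algebra L A]

variable (p) in
theorem exists_pow_mul_mem_tateBall {m : ℕ} (f : tateAlgebra L m) :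
    ∃ k : ℕ, (p : tateAlgebra L m) ^ k * f ∈ tateBall L m := by
  have hfin := mem_tateAlgebra_iff.1 f.2 1 one_pos
  obtain ⟨C, hC⟩ := (hfin.image fun t => ‖MvPowerSeries.coeff t f.1‖).bddAbove
  have hC' : ∀ t, ‖MvPowerSeries.coeff t f.1‖ ≤ max C 1 := fun t => by
    by_cases h : 1 ≤ ‖MvPowerSeries.coeff t f.1‖
    · exact (hC ⟨t, h, rfl⟩).trans (le_max_left _ _)
    · exact (not_le.1 h).le.trans (le_max_right _ _)
  obtain ⟨k, hk⟩ := exists_pow_lt_of_lt_one (inv_pos.2 (lt_max_of_lt_right one_pos : 0 < max C 1))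
    (norm_natCast_prime_lt_one L p)
  refine ⟨k, fun t => ?_⟩
  have h1 : MvPowerSeries.coeff t ((p : tateAlgebra L m) ^ k * f).1
      = (p : L) ^ k * MvPowerSeries.coeff t f.1 := by
    rw [← Nat.cast_pow, ← nsmul_eq_mul, ← Nat.cast_pow, ← nsmul_eq_mul]
    exact map_nsmul (MvPowerSeries.coeff t) _ _
  rw [h1, norm_mul, norm_pow]
  calc _ ≤ (max C 1)⁻¹ * max C 1 :=
        mul_le_mul hk.le (hC' t) (norm_nonneg _) (by positivity)
    _ = 1 := inv_mul_cancel₀ (by positivity)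

variable (p) in
theorem isUnit_natCast_prime (L : Type*) [NontriviallyNormedField L] [NormedAlgebra ℚ_[p] L]
    (A : Type*) [CommRing A] [Algebra L A] : IsUnit (p : A) := by
  rw [← map_natCast (algebraMap L A)]
  exact (natCast_prime_ne_zero L p).isUnit.map _

variable [FiniteDimensional ℚ_[p] L]

variable (p) in
/-- The image of the unit ball of a Tate algebra in a quotient. -/
theorem exists_integral_model (hA : IsAffinoidAlgebra L A) :
    ∃ B : Subring A, IsNoetherianRing B ∧ (∀ M : Ideal B, M.IsMaximal → (p : B) ∈ M) ∧
      Algebra.FiniteType ℤ (B ⧸ Ideal.span {(p : B)}) ∧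
      (∀ c : L, ‖c‖ ≤ 1 → algebraMap L A c ∈ B) ∧ ∀ a : A, ∃ k : ℕ, (p : A) ^ k * a ∈ B := by
  obtain ⟨m, φ, hφ⟩ := hA
  let ρ : tateBall L m →+* A := φ.toRingHom.comp (tateBall L m).subtype
  have hρ := ρ.rangeRestrict_surjective
  have hN := isNoetherianRing_tateBall L p m
  refine ⟨ρ.range, isNoetherianRing_of_surjective _ _ _ hρ, fun M hM => ?_, ?_, fun c hc => ?_,
    fun a => ?_⟩
  · have h1 : (M.comap ρ.rangeRestrict).IsMaximal := Ideal.comap_isMaximal_of_surjective _ hρ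
    have h2 := IsAdicComplete.le_jacobson_bot (Ideal.span {(p : tateBall L m)})
      (Ideal.mem_span_singleton_self _)
    rw [Ideal.jacobson, Ideal.mem_sInf] at h2
    simpa using h2 ⟨bot_le, h1⟩
  · have := finiteType_tateBall_quotient L m p
    have hle : Ideal.span {(p : tateBall L m)} ≤
        (Ideal.span {(p : ρ.range)}).comap ρ.rangeRestrict := by
      rw [Ideal.span_singleton_le_iff_mem, Ideal.mem_comap, map_natCast]
      exact Ideal.mem_span_singleton_self _
    exact this.of_surjective
      { Ideal.quotientMap (Ideal.span {(p : ρ.range)}) ρ.rangeRestrict hle with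
        commutes' := fun r => by simp }
      (Ideal.quotientMap_surjective (H := hle) hρ)
  · refine ⟨ballMonomial 0 c hc, ?_⟩
    rw [← φ.commutes]
    rfl
  · obtain ⟨f, rfl⟩ := hφ a
    obtain ⟨k, hk⟩ := exists_pow_mul_mem_tateBall p f
    exact ⟨k, ⟨_, hk⟩, by simp [ρ]⟩

theorem IsAffinoidAlgebra.isNoetherianRing (p : ℕ) [Fact p.Prime] [NormedAlgebra ℚ_[p] L]
    [FiniteDimensional ℚ_[p] L] (hA : IsAffinoidAlgebra L A) : IsNoetherianRing A := by
  obtain ⟨B, hB, -, -, -, hk⟩ := exists_integral_model p hA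
  have : IsLocalization.Away (p : B) A :=
    { map_units := by
        rintro ⟨_, n, rfl⟩
        simpa using (isUnit_natCast_prime p L A).pow n
      surj := fun a => by
        obtain ⟨k, h⟩ := hk a
        refine ⟨⟨⟨_, h⟩, ⟨_, k, rfl⟩⟩, ?_⟩
        simp only [map_pow, map_natCast]
        exact mul_comm _ _
      exists_of_eq := fun {x y} h => ⟨1, by simpa using Subtype.ext h⟩ }
  exact IsLocalization.isNoetherianRing (Submonoid.powers (p : B)) A hB

/-- Nullstellensatz. A prime of `B` containing `p` but not minimal over it would produce a nonzero
nonunit of `A`. Hence `B / p` has dimension zero, so it is finite over `ℤ`, and successive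
approximation makes `B` finite over `ℤ_[p]`. -/
theorem IsAffinoidAlgebra.isIntegral_of_isField (p : ℕ) [Fact p.Prime] [NormedAlgebra ℚ_[p] L]
    [FiniteDimensional ℚ_[p] L] (hA : IsAffinoidAlgebra L A) (hF : IsField A) (a : A) :
    IsIntegral L a := by
  classical
  have : IsDomain A := hF.isDomain
  obtain ⟨B, hB, hmax, hft, hO, hk⟩ := exists_integral_model p hA
  have hpA := isUnit_natCast_prime p L A
  have hp0 : (p : B) ≠ 0 := fun h => hpA.ne_zero (by simpa using congrArg Subtype.val h)
  have hmin : ∀ M : Ideal B, M.IsPrime → (p : B) ∈ M → M ∈ (Ideal.span {(p : B)}).minimalPrimes := by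
    intro M hM hpM
    by_contra hcon
    obtain ⟨g, hgM, hg⟩ := exists_mem_forall_minimalPrimes_notMem _ hcon hpM
    obtain ⟨Q, hQ, -, hgQ, hpQ⟩ := exists_prime_le_notMem hp0 hgM hg
    refine not_isUnit_of_mem_prime hk hpQ hgQ ?_
    have hg0 : (g : A) ≠ 0 := fun h => by
      obtain ⟨q, hq, -⟩ := Ideal.exists_minimalPrimes_le
        ((Ideal.span_singleton_le_iff_mem M).2 hpM)
      refine hg q hq ?_
      rw [show g = 0 from Subtype.ext h]
      exact zero_mem _
    obtain ⟨b, hb⟩ := hF.mul_inv_cancel hg0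
    exact IsUnit.of_mul_eq_one _ hb
  have hfin : Module.Finite ℤ (B ⧸ Ideal.span {(p : B)}) := by
    have : Ring.KrullDimLE 0 (B ⧸ Ideal.span {(p : B)}) := by
      refine Ring.krullDimLE_zero_iff.2 fun P hP => ?_
      have hpP : (p : B) ∈ P.comap (Ideal.Quotient.mk _) := by
        rw [Ideal.mem_comap, Ideal.Quotient.eq_zero_iff_mem.2 (Ideal.mem_span_singleton_self _)]
        exact zero_mem _
      obtain ⟨M, hM, hPM⟩ := Ideal.exists_le_maximal (P.comap (Ideal.Quotient.mk _))
        (Ideal.comap_ne_top _ hP.ne_top)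
      have h1 := (hmin M hM.isPrime (hmax M hM)).2
        ⟨inferInstance, (Ideal.span_singleton_le_iff_mem _).2 hpP⟩ hPM
      have h2 : P.comap (Ideal.Quotient.mk _) = M := le_antisymm hPM h1
      have h3 : (P.comap (Ideal.Quotient.mk (Ideal.span {(p : B)}))).IsMaximal := h2 ▸ hM
      rw [← Ideal.map_comap_of_surjective _ (Ideal.Quotient.mk_surjective (I := Ideal.span {(p : B)})) P]
      refine (Ideal.map_eq_top_or_isMaximal_of_surjective _ Ideal.Quotient.mk_surjective h3).resolve_left ?_
      rw [Ideal.map_comap_of_surjective _ Ideal.Quotient.mk_surjective]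
      exact hP.ne_top
    have : IsArtinianRing (B ⧸ Ideal.span {(p : B)}) :=
      isArtinianRing_iff_isNoetherianRing_krullDimLE_zero.2 ⟨inferInstance, this⟩
    have := isJacobsonRing_int
    -- An Artinian algebra of finite type over the Jacobson ring `ℤ` is a finite module.
    exact Module.finite_of_isArtinianRing ℤ _
  let ι : ℤ_[p] →+* B := (((algebraMap L A).comp (algebraMap ℚ_[p] L)).comp
    PadicInt.Coe.ringHom).codRestrict B fun x => hO _ (by
      rw [norm_algebraMap']; exact x.2)
  let : Algebra ℤ_[p] B := ι.toAlgebra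
  have hprec : IsPrecomplete (Ideal.span {(p : ℤ_[p])}) ℤ_[p] := by
    rw [← PadicInt.maximalIdeal_eq_span_p]; infer_instance
  obtain ⟨n, w, hw⟩ := Module.Finite.exists_fin (R := ℤ) (M := B ⧸ Ideal.span {(p : B)})
  choose v hv using fun i => Ideal.Quotient.mk_surjective (I := Ideal.span {(p : B)}) (w i)
  have hsmul : ∀ (k : ℕ) (y : B), (p : ℤ_[p]) ^ k • y = (p : B) ^ k * y := fun k y => by
    rw [Algebra.smul_def, map_pow, map_natCast]
  have hpne : Ideal.span {(p : B)} ≠ ⊤ := by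
    obtain ⟨M, hM⟩ := Ideal.exists_maximal B
    exact fun h => hM.ne_top (top_le_iff.1 (h ▸ (Ideal.span_singleton_le_iff_mem _).2 (hmax M hM)))
  have key := exists_sum_smul_of_isPrecomplete (M := B) (p : ℤ_[p]) (fun x hx => by
      have : x ∈ ⨅ i : ℕ, Ideal.span {(p : B)} ^ i := (Submodule.mem_iInf _).2 fun i => by
        obtain ⟨y, rfl⟩ := hx i
        rw [hsmul, Ideal.span_singleton_pow]
        exact Ideal.mem_span_singleton.2 (dvd_mul_right _ _)
      rwa [Ideal.iInf_pow_eq_bot_of_isDomain _ hpne] at this) v (fun x => by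
      have hx : Ideal.Quotient.mk (Ideal.span {(p : B)}) x ∈ Submodule.span ℤ (Set.range w) := by
        rw [hw]; trivial
      obtain ⟨c, hc⟩ := (Submodule.mem_span_range_iff_exists_fun _).1 hx
      have h0 : Ideal.Quotient.mk (Ideal.span {(p : B)}) (x - ∑ i, c i • v i) = 0 := by
        rw [map_sub, map_sum, ← hc]
        simp [hv]
      obtain ⟨y, hy⟩ := Ideal.mem_span_singleton.1 (Ideal.Quotient.eq_zero_iff_mem.1 h0)
      refine ⟨fun i => (c i : ℤ_[p]), y, ?_⟩
      have h1 := hsmul 1 y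
      rw [pow_one, pow_one] at h1
      rw [h1, ← hy]
      simp [Algebra.smul_def])
  have : Module.Finite ℤ_[p] B := ⟨⟨Finset.univ.image v, top_le_iff.1 fun x _ => by
    obtain ⟨c, rfl⟩ := key x
    exact sum_mem fun i _ => Submodule.smul_mem _ _ (Submodule.subset_span (by simp))⟩⟩
  have hint : ∀ b : B, IsIntegral L (b : A) := fun b => by
    obtain ⟨q, hq, hqb⟩ := Algebra.IsIntegral.isIntegral (R := ℤ_[p]) b
    refine ⟨q.map ((algebraMap ℚ_[p] L).comp PadicInt.Coe.ringHom), hq.map _, ?_⟩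
    rw [Polynomial.eval₂_map]
    have := congrArg B.subtype hqb
    rw [Polynomial.hom_eval₂, map_zero] at this
    exact this
  obtain ⟨k, hb⟩ := hk a
  have h1 : a = algebraMap L A ((p : L) ^ k)⁻¹ * ((p : A) ^ k * a) := by
    rw [← mul_assoc, ← map_natCast (algebraMap L A) p, ← map_pow, ← map_mul,
      inv_mul_cancel₀ (pow_ne_zero _ (natCast_prime_ne_zero L p)), map_one, one_mul]
  rw [h1]
  exact isIntegral_algebraMap.mul (hint ⟨_, hb⟩)

/-- If `A` is not a field, some maximal `M` of `B` is not minimal over `p` and contains a `g`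
outside all minimal primes over `p`. Perturbing `g` by `p` times combinations of generators of `M`
gives uncountably many nonunits of `A`, whereas each maximal ideal of `A` contains only finitely
many of them. -/
theorem IsAffinoidAlgebra.isField_of_countable (p : ℕ) [Fact p.Prime] [NormedAlgebra ℚ_[p] L]
    [FiniteDimensional ℚ_[p] L] [IsDomain A] (hA : IsAffinoidAlgebra L A)
    (hc : Countable (MaximalSpectrum A)) : IsField A := by
  by_contra hF
  obtain ⟨B, hB, hmax, -, hO, hk⟩ := exists_integral_model p hA
  have hpA := isUnit_natCast_prime p L A
  have hp0 : (p : B) ≠ 0 := fun h => hpA.ne_zero (by simpa using congrArg Subtype.val h)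
  obtain ⟨m, hm0, hm⟩ := Ring.not_isField_iff_exists_prime.1 hF
  have hpm : (p : A) ∉ m := fun h => hm.ne_top (Ideal.eq_top_of_isUnit_mem _ h hpA)
  obtain ⟨d, hdm, hd0⟩ := Submodule.exists_mem_ne_zero_of_ne_bot hm0
  obtain ⟨M, hM, hqM⟩ := Ideal.exists_le_maximal (m.comap B.subtype)
    (Ideal.comap_ne_top _ hm.ne_top)
  have hpM := hmax M hM
  have hMmin : M ∉ (Ideal.span {(p : B)}).minimalPrimes := fun hmin => by
    have h1 := Ideal.height_le_one_of_isPrincipal_of_mem_minimalPrimes _ _ hmin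
    have hlt : m.comap B.subtype < M := lt_of_le_of_ne hqM fun h => hpm (by
      have : (p : B) ∈ m.comap B.subtype := h ▸ hpM
      simpa using this)
    have hbot : ⊥ < m.comap B.subtype := by
      obtain ⟨k, h⟩ := hk d
      refine bot_lt_iff_ne_bot.2 fun h0 => ?_
      have h2 : (⟨_, h⟩ : B) ∈ m.comap B.subtype := m.mul_mem_left _ hdm
      rw [h0, Ideal.mem_bot] at h2
      exact mul_ne_zero (pow_ne_zero k hpA.ne_zero) hd0 (congrArg Subtype.val h2)
    have h2 := Ideal.height_add_one_le_of_lt_of_isPrime hlt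
    have h3 := Ideal.height_add_one_le_of_lt_of_isPrime hbot
    have h4 : (1 : ℕ∞) + 1 ≤ 1 := (add_le_add_left (le_trans (by simp) h3) 1).trans (h2.trans h1)
    exact absurd h4 (by norm_num)
  obtain ⟨g, hgM, hg⟩ := exists_mem_forall_minimalPrimes_notMem _ hMmin hpM
  obtain ⟨r, w, hw⟩ := Submodule.fg_iff_exists_fin_generating_family.1 (IsNoetherian.noetherian M)
  have hS : ¬ (Metric.ball (0 : L) 1).Countable := fun h => by
    have := FiniteDimensional.complete ℚ_[p] L
    have h1 := continuum_le_cardinal_of_isOpen L Metric.isOpen_ball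
      (Metric.nonempty_ball.2 (one_pos : (0 : ℝ) < 1) : (Metric.ball (0 : L) 1).Nonempty)
    exact absurd (h1.trans (Cardinal.le_aleph0_iff_set_countable.2 h))
      (not_le.2 Cardinal.aleph0_lt_continuum)
  -- The vector `g` comes first and so gets the coefficient `c ^ 0 = 1`, while all the others are
  -- divisible by `p`: the combination stays congruent to `g` modulo `p`. A maximal ideal of `A`
  -- containing all these vectors would contain `M`, hence the unit `p`.
  obtain ⟨c, hc1, hc⟩ := exists_sum_pow_smul_notMem (Metric.ball (0 : L) 1) hS
    (Fin.cons (g : A) fun s => (p : A) * w s)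
    (fun n : MaximalSpectrum A => n.asIdeal.restrictScalars L) fun n => by
      by_contra! h
      have hn : (p : A) ∉ n.asIdeal := fun h =>
        n.isMaximal.ne_top (Ideal.eq_top_of_isUnit_mem _ h hpA)
      have hle : M ≤ n.asIdeal.comap B.subtype := by
        rw [← hw, Submodule.span_le]
        rintro _ ⟨s, rfl⟩
        have h2 := h s.succ
        rw [Fin.cons_succ] at h2
        exact (n.isMaximal.isPrime.mem_or_mem h2).resolve_left hn
      exact hn (by simpa using hle hpM)
  let cB : B := ⟨algebraMap L A c, hO c (mem_ball_zero_iff.1 hc1).le⟩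
  let f : B := g + p * ∑ s, cB ^ (s.1 + 1) * w s
  have hf : (f : A) = ∑ s : Fin (r + 1), c ^ (s : ℕ) •
      (Fin.cons (g : A) (fun s => (p : A) * w s) : Fin (r + 1) → A) s := by
    rw [Fin.sum_univ_succ]
    simp [f, cB, Algebra.smul_def, Finset.mul_sum, mul_left_comm]
  have hfM : f ∈ M := add_mem hgM (M.mul_mem_right _ hpM)
  obtain ⟨Q, hQ, -, hfQ, hpQ⟩ := exists_prime_le_notMem hp0 hfM fun q hq hfq => hg q hq (by
    have hpq : (p : B) ∈ q := hq.1.2 (Ideal.mem_span_singleton_self _)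
    exact (Ideal.add_mem_iff_left _ (q.mul_mem_right _ hpq)).1 hfq)
  obtain ⟨n, hn, hfn⟩ := exists_max_ideal_of_mem_nonunits (not_isUnit_of_mem_prime hk hpQ hfQ)
  exact hc ⟨n, hn⟩ (hf ▸ hfn)

end AffinoidAlgebra

/-! ### Maximal ideals under homomorphisms, and the algebraic form of the theorem. -/

section Maximal

variable {L : Type*} [NontriviallyNormedField L] [IsUltrametricDist L]
  {A : Type*} [CommRing A] [Algebra L A] {B : Type*} [CommRing B] [Algebra L B]

theorem IsAffinoidAlgebra.of_surjective (hA : IsAffinoidAlgebra L A) (f : A →ₐ[L] B)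
    (hf : Function.Surjective f) : IsAffinoidAlgebra L B := by
  obtain ⟨m, φ, hφ⟩ := hA
  exact ⟨m, f.comp φ, hf.comp hφ⟩

theorem IsAffinoidAlgebra.quotient (hA : IsAffinoidAlgebra L A) (I : Ideal A) :
    IsAffinoidAlgebra L (A ⧸ I) :=
  hA.of_surjective (Ideal.Quotient.mkₐ L I) Ideal.Quotient.mk_surjective

theorem IsAffinoidAlgebra.isIntegral_quotient (p : ℕ) [Fact p.Prime] [NormedAlgebra ℚ_[p] L]
    [FiniteDimensional ℚ_[p] L] (hA : IsAffinoidAlgebra L A) (I : Ideal A) [hI : I.IsMaximal]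
    (a : A ⧸ I) : IsIntegral L a :=
  (hA.quotient I).isIntegral_of_isField p
    ((Ideal.Quotient.maximal_ideal_iff_isField_quotient I).1 hI) a

/-- The quotient of `A` embeds in `B ⧸ I`, which is algebraic over `L` by the Nullstellensatz, and a
domain integral over a field is a field. -/
theorem IsAffinoidAlgebra.isMaximal_comap (p : ℕ) [Fact p.Prime] [NormedAlgebra ℚ_[p] L]
    [FiniteDimensional ℚ_[p] L] (hB : IsAffinoidAlgebra L B) (φ : A →ₐ[L] B) (I : Ideal B)
    [hI : I.IsMaximal] : (I.comap φ).IsMaximal := by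
  let ψ : A ⧸ I.comap φ →ₐ[L] B ⧸ I := Ideal.quotientMapₐ I φ le_rfl
  have hψ : Function.Injective ψ := Ideal.quotientMap_injective' (H := le_rfl) le_rfl
  have hint : Algebra.IsIntegral L (A ⧸ I.comap φ) :=
    ⟨fun a => (isIntegral_algHom_iff ψ hψ).1 (hB.isIntegral_quotient p I _)⟩
  have : (I.comap φ).IsPrime := inferInstance
  exact Ideal.Quotient.maximal_of_isField _ (isField_of_isIntegral_of_isField' (Field.toIsField L))

/-- Countably many affinoid spaces of dimension `< n` cannot cover one of dimension `≥ n`. -/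
theorem exists_maximalSpectrum_ne_comap (p : ℕ) [Fact p.Prime] [NormedAlgebra ℚ_[p] L]
    [FiniteDimensional ℚ_[p] L] (hA : IsAffinoidAlgebra L A) {ι : Type*} [Countable ι]
    (C : ι → Type*) [∀ i, CommRing (C i)] [∀ i, Algebra L (C i)] [∀ i, IsNoetherianRing (C i)]
    (φ : ∀ i, A →ₐ[L] C i) {n : ℕ} (hn : n ≤ ringKrullDim A) (hC : ∀ i, ringKrullDim (C i) < n) :
    ∃ z : MaximalSpectrum A, ∀ i (y : MaximalSpectrum (C i)),
      z.asIdeal ≠ y.asIdeal.comap (φ i) := by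
  classical
  have hN := hA.isNoetherianRing p
  -- For `n = 0` the ring `A` is nonzero and no `C i` has a maximal ideal, so any maximal ideal of
  -- `A` works.
  obtain _ | k := n
  · have hnt : Nontrivial A := by
      by_contra h
      rw [not_nontrivial_iff_subsingleton] at h
      rw [ringKrullDim_eq_bot_of_subsingleton] at hn
      simp at hn
    refine ⟨Classical.arbitrary _, fun i y => ?_⟩
    have : Nontrivial (C i) := ⟨0, 1, fun h => y.isMaximal.ne_top
      ((Ideal.eq_top_iff_one _).2 (h ▸ zero_mem _))⟩
    exact absurd (hC i) (not_lt.2 (by simpa using ringKrullDim_nonneg_of_nontrivial))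
  obtain ⟨m, hm, hkm⟩ : ∃ m : Ideal A, m.IsMaximal ∧ (k : ℕ∞) < m.height := by
    by_contra! h
    have h1 := (ringKrullDim_le_iff_isMaximal_height_le (R := A) (k : WithBot ℕ∞)).2
      fun m hm => by exact_mod_cast h m hm
    have h2 : ((k + 1 : ℕ) : WithBot ℕ∞) ≤ (k : ℕ) := hn.trans h1
    have h3 : k + 1 ≤ k := by exact_mod_cast h2
    omega
  have hL : ¬ (Set.univ : Set L).Countable := fun h => by
    have := FiniteDimensional.complete ℚ_[p] L
    have h1 := continuum_le_cardinal_of_isOpen L (isOpen_univ : IsOpen (Set.univ : Set L))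
      Set.univ_nonempty
    exact absurd (h1.trans (Cardinal.le_aleph0_iff_set_countable.2 h))
      (not_le.2 Cardinal.aleph0_lt_continuum)
  have hfin : ∀ (s : Finset A) i, (Ideal.span (φ i '' s)).minimalPrimes.Finite := fun s i =>
    Ideal.finite_minimalPrimes_of_isNoetherianRing _ _
  -- Each new element is generic in `m`: it avoids the countably many minimal primes over the
  -- earlier elements whose contraction does not contain `m`. A prime over the enlarged set then
  -- strictly contains such a minimal prime and gains one in height.
  have key : ∀ j : ℕ, ∃ s : Finset A, (s : Set A) ⊆ m ∧ s.card ≤ j ∧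
      ∀ i (q : Ideal (C i)), q.IsPrime → Ideal.span (φ i '' s) ≤ q → ¬ m ≤ q.comap (φ i) →
        (j : ℕ∞) ≤ q.height := by
    intro j
    induction j with
    | zero => exact ⟨∅, by simp, by simp, by simp⟩
    | succ j ih =>
      obtain ⟨s, hsm, hsj, hs⟩ := ih
      obtain ⟨r, w, hw⟩ := Submodule.fg_iff_exists_fin_generating_family.1 (IsNoetherian.noetherian m)
      have hwm : ∀ s, w s ∈ m := fun s => hw ▸ Submodule.subset_span (Set.mem_range_self s)
      have hcount : Countable (Σ i, (Ideal.span (φ i '' s)).minimalPrimes) := by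
        have := fun i => (hfin s i).countable.to_subtype
        infer_instance
      obtain ⟨c, -, hc⟩ := exists_sum_pow_smul_notMem Set.univ hL w
        (fun x : {x : Σ i, (Ideal.span (φ i '' s)).minimalPrimes //
            ¬ m ≤ (x.2 : Ideal (C x.1)).comap (φ x.1)} =>
          ((x.1.2 : Ideal (C x.1.1)).comap (φ x.1.1)).restrictScalars L) fun x => by
        by_contra! h
        refine x.2 ?_
        refine hw.symm.le.trans (Submodule.span_le.2 ?_)
        rintro _ ⟨t, rfl⟩
        exact h t
      let f := ∑ t : Fin r, c ^ (t : ℕ) • w t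
      have hfm : f ∈ m := sum_mem fun t _ => by
        rw [Algebra.smul_def]
        exact m.mul_mem_left _ (hwm t)
      refine ⟨insert f s, ?_, (Finset.card_insert_le _ _).trans (by omega), fun i q hq hsq hmq => ?_⟩
      · rw [Finset.coe_insert]
        exact Set.insert_subset hfm hsm
      · rw [Finset.coe_insert, Set.image_insert_eq, Ideal.span_insert, sup_le_iff,
          Ideal.span_singleton_le_iff_mem] at hsq
        obtain ⟨q', hq', hqq⟩ := Ideal.exists_minimalPrimes_le hsq.2
        have hmq' : ¬ m ≤ q'.comap (φ i) := fun h => hmq (h.trans (Ideal.comap_mono hqq))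
        have : q'.IsPrime := hq'.1.1
        have hlt : q' < q := lt_of_le_of_ne hqq fun h => by
          refine hc ⟨⟨i, q', hq'⟩, hmq'⟩ ?_
          rw [← h] at hsq
          exact hsq.1
        have h1 := Ideal.height_add_one_le_of_lt_of_isPrime hlt
        push_cast
        exact (add_le_add_left (hs i q' this hq'.1.2 hmq') 1).trans h1
  obtain ⟨s, hsm, hsk, hs⟩ := key k
  obtain ⟨P, hP, hPm⟩ := Ideal.exists_minimalPrimes_le (Ideal.span_le.2 hsm)
  have hPp : P.IsPrime := hP.1.1
  -- Krull's height theorem bounds the height of `P` by `k`, which is less than that of `m`.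
  have hPne : P ≠ m := fun h => by
    have h1 := Ideal.height_le_card_of_mem_minimalPrimes_span_finset hP
    rw [h] at h1
    exact absurd (hkm.trans_le (h1.trans (by exact_mod_cast hsk))) (lt_irrefl _)
  by_contra! hcon
  have hPF : ¬ IsField (A ⧸ P) := fun h =>
    hPne ((Ideal.Quotient.maximal_of_isField P h).eq_of_le hm.ne_top hPm)
  refine hPF ((hA.quotient P).isField_of_countable p ?_)
  let T : Set (Ideal A) := {m} ∪ ⋃ i, (Ideal.comap (φ i)) '' (Ideal.span (φ i '' s)).minimalPrimes
  have hT : T.Countable := (Set.countable_singleton _).union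
    (Set.countable_iUnion fun i => ((hfin s i).image _).countable)
  have := hT.to_subtype
  have hmaxc : ∀ z : MaximalSpectrum (A ⧸ P), (z.asIdeal.comap (Ideal.Quotient.mk P)).IsMaximal :=
    fun z => by
      have := z.isMaximal
      exact Ideal.comap_isMaximal_of_surjective _ Ideal.Quotient.mk_surjective
  have hmem : ∀ z : MaximalSpectrum (A ⧸ P), z.asIdeal.comap (Ideal.Quotient.mk P) ∈ T := by
    intro z
    have hz := hmaxc z
    by_cases hzm : z.asIdeal.comap (Ideal.Quotient.mk P) = m
    · exact Or.inl hzm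
    refine Or.inr (Set.mem_iUnion.2 ?_)
    obtain ⟨i, y, hy⟩ := hcon ⟨_, hz⟩
    change z.asIdeal.comap (Ideal.Quotient.mk P) = _ at hy
    refine ⟨i, y.asIdeal, ?_, hy.symm⟩
    have hyp := y.isMaximal.isPrime
    have hmy : ∀ q : Ideal (C i), q ≤ y.asIdeal → ¬ m ≤ q.comap (φ i) := fun q hq h =>
      hzm (hm.eq_of_le hz.ne_top (h.trans ((Ideal.comap_mono hq).trans hy.ge))).symm
    have hsy : Ideal.span (φ i '' s) ≤ y.asIdeal := by
      rw [Ideal.span_le]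
      rintro _ ⟨a, ha, rfl⟩
      have haP : a ∈ P := hP.1.2 (Ideal.subset_span ha)
      have : a ∈ y.asIdeal.comap (φ i) := by
        rw [← hy, Ideal.mem_comap, Ideal.Quotient.eq_zero_iff_mem.2 haP]
        exact zero_mem _
      exact this
    obtain ⟨q, hq, hqy⟩ := Ideal.exists_minimalPrimes_le hsy
    have hqp : q.IsPrime := hq.1.1
    -- A strict inclusion would give `y` height at least `k + 1`, more than `dim C i` allows; so `y`
    -- is one of finitely many minimal primes.
    rcases hqy.eq_or_lt with h | hlt
    · exact h ▸ hq
    have h1 := Ideal.height_add_one_le_of_lt_of_isPrime hlt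
    have h2 := (add_le_add_left (hs i q hqp hq.1.2 (hmy q hqy)) 1).trans h1
    have h3 : (y.asIdeal.height : WithBot ℕ∞) < ((k + 1 : ℕ) : WithBot ℕ∞) :=
      Ideal.height_le_ringKrullDim_of_isPrime.trans_lt (hC i)
    have h4 : y.asIdeal.height < ((k + 1 : ℕ) : ℕ∞) := by exact_mod_cast h3
    exact absurd h4 (not_lt.2 (by exact_mod_cast h2))
  refine Function.Injective.countable (f := fun z => (⟨_, hmem z⟩ : T)) fun z z' h => ?_
  exact MaximalSpectrum.ext (Ideal.comap_injective_of_surjective _ Ideal.Quotient.mk_surjective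
    (congrArg Subtype.val h))

end Maximal

/-! ### Values at points, and the points of a represented subdomain. -/

section Points

variable {L : Type u} [NontriviallyNormedField L] {A : Type*} [CommRing A] [Algebra L A]

theorem absAt_of_mem {x : MaximalSpectrum A} {f : A} (h : f ∈ x.asIdeal) : absAt L x f = 0 := by
  have : Nontrivial (A ⧸ x.asIdeal) := Ideal.Quotient.nontrivial_iff.2 x.isMaximal.ne_top
  rw [absAt, Ideal.Quotient.eq_zero_iff_mem.2 h, minpoly.zero, ← pow_one Polynomial.X,
    spectralValue_X_pow]

theorem isRationalSubdomain_univ :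
    IsRationalSubdomain L (Set.univ : Set (MaximalSpectrum A)) :=
  ⟨0, Fin.elim0, 1, by simp, by simp⟩

theorem spPreimage_eq_univ_iff {B : Type*} [CommRing B] [Algebra L B] {φ : A →ₐ[L] B}
    {W : Set (MaximalSpectrum A)} : spPreimage φ W = Set.univ ↔
      ∀ y : MaximalSpectrum B, ∃ x ∈ W, x.asIdeal = y.asIdeal.comap φ :=
  Set.eq_univ_iff_forall

theorem spPreimage_comp_eq_univ {B C : Type*} [CommRing B] [Algebra L B] [CommRing C] [Algebra L C]
    {φ : A →ₐ[L] B} {W : Set (MaximalSpectrum A)} (h : spPreimage φ W = Set.univ) (g : B →ₐ[L] C)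
    (hg : Function.Surjective g) : spPreimage (g.comp φ) W = Set.univ := by
  refine spPreimage_eq_univ_iff.2 fun y => ?_
  have := y.isMaximal
  exact spPreimage_eq_univ_iff.1 h ⟨y.asIdeal.comap g, Ideal.comap_isMaximal_of_surjective g hg⟩

theorem absAt_algebraMap (x : MaximalSpectrum A) (c : L) :
    absAt L x (algebraMap L A c) = ‖c‖ := by
  have : Nontrivial (A ⧸ x.asIdeal) := Ideal.Quotient.nontrivial_iff.2 x.isMaximal.ne_top
  rw [absAt, show Ideal.Quotient.mk x.asIdeal (algebraMap L A c) =
    algebraMap L (A ⧸ x.asIdeal) c from rfl, minpoly.eq_X_sub_C, spectralValue_X_sub_C]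

variable [IsUltrametricDist L]

theorem IsAffinoidAlgebra.absAt_pos (p : ℕ) [Fact p.Prime] [NormedAlgebra ℚ_[p] L]
    [FiniteDimensional ℚ_[p] L] (hA : IsAffinoidAlgebra L A) {x : MaximalSpectrum A} {f : A}
    (h : f ∉ x.asIdeal) : 0 < absAt L x f := by
  refine lt_of_le_of_ne (spectralValue_nonneg _) fun h0 => h ?_
  have := x.isMaximal
  have hint := hA.isIntegral_quotient p x.asIdeal (Ideal.Quotient.mk x.asIdeal f)
  have h1 := (spectralValue_eq_zero_iff (minpoly.monic hint)).1 h0.symm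
  have h2 := minpoly.aeval L (Ideal.Quotient.mk x.asIdeal f)
  rw [h1, map_pow, Polynomial.aeval_X] at h2
  exact Ideal.Quotient.eq_zero_iff_mem.1 (eq_zero_of_pow_eq_zero h2)

theorem IsRationalSubdomain.isSpOpen {W : Set (MaximalSpectrum A)}
    (hW : IsRationalSubdomain L W) : IsSpOpen L W := by
  refine ⟨{W}, by simpa using hW, by simp, fun B _ _ _ φ hφ => ?_⟩
  exact ⟨{Set.univ}, by simp, by simpa using isRationalSubdomain_univ, by simp, by simp [hφ]⟩

/-- Every affinoid algebra has an isomorphic copy in the universe of the base field. -/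
theorem IsAffinoidAlgebra.exists_algEquiv (hA : IsAffinoidAlgebra L A) :
    ∃ (B : Type u) (_ : CommRing B) (_ : Algebra L B), IsAffinoidAlgebra L B ∧
      Nonempty (A ≃ₐ[L] B) := by
  obtain ⟨m, φ, hφ⟩ := hA
  exact ⟨tateAlgebra L m ⧸ RingHom.ker φ, inferInstance, inferInstance,
    ⟨m, Ideal.Quotient.mkₐ L _, Ideal.Quotient.mk_surjective⟩,
    ⟨(Ideal.quotientKerAlgEquivOfSurjective hφ).symm⟩⟩

variable {A' : Type*} [CommRing A'] [Algebra L A'] {φ : A →ₐ[L] A'} {W : Set (MaximalSpectrum A)}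

theorem Represents.existsUnique_lift (h : Represents φ W) {B : Type*} [CommRing B] [Algebra L B]
    (hB : IsAffinoidAlgebra L B) (ψ : A →ₐ[L] B) (hψ : spPreimage ψ W = Set.univ) :
    ∃! χ : A' →ₐ[L] B, χ.comp φ = ψ := by
  obtain ⟨B', _, _, hB', ⟨e⟩⟩ := hB.exists_algEquiv
  obtain ⟨χ, hχ, huniq⟩ := h.2.2 B' hB' (e.toAlgHom.comp ψ)
    (spPreimage_comp_eq_univ hψ _ e.surjective)
  refine ⟨e.symm.toAlgHom.comp χ, ?_, fun χ' hχ' => ?_⟩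
  · change (e.symm.toAlgHom.comp χ).comp φ = ψ
    rw [AlgHom.comp_assoc, hχ]
    ext; simp
  · rw [← huniq (e.toAlgHom.comp χ') (by
      change (e.toAlgHom.comp χ').comp φ = _
      rw [AlgHom.comp_assoc, hχ'])]
    ext; simp

/-- The point `z` factors through `A'` by the universal property, giving `χ`. If `y` lies over `z`,
then `A' → A' ⧸ y` and `A' → A ⧸ z → A' ⧸ y` agree on `A`, so uniqueness identifies them and `ker χ
≤ y`. Existence and uniqueness of points over `z` follow. -/
theorem Represents.exists_algHom_quotient (hA : IsAffinoidAlgebra L A) (h : Represents φ W)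
    {z : MaximalSpectrum A} (hz : z ∈ W) :
    ∃ χ : A' →ₐ[L] A ⧸ z.asIdeal, χ.comp φ = Ideal.Quotient.mkₐ L z.asIdeal ∧
      ∀ y : MaximalSpectrum A', y.asIdeal.comap φ = z.asIdeal → y.asIdeal = RingHom.ker χ := by
  obtain ⟨χ, hχ, -⟩ := h.existsUnique_lift (hA.quotient z.asIdeal)
    (Ideal.Quotient.mkₐ L z.asIdeal) (spPreimage_eq_univ_iff.2 fun y => by
      refine ⟨z, hz, z.isMaximal.eq_of_le (Ideal.comap_ne_top _ y.isMaximal.ne_top) fun a ha => ?_⟩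
      rw [Ideal.mem_comap, Ideal.Quotient.mkₐ_eq_mk, Ideal.Quotient.eq_zero_iff_mem.2 ha]
      exact zero_mem _)
  have hχs : Function.Surjective χ := fun a => by
    obtain ⟨b, rfl⟩ := Ideal.Quotient.mk_surjective a
    exact ⟨φ b, DFunLike.congr_fun hχ b⟩
  refine ⟨χ, hχ, fun y hy => ?_⟩
  have hzm := z.isMaximal
  have hk : (RingHom.ker χ).IsMaximal := by
    let : Field (A ⧸ z.asIdeal) := Ideal.Quotient.field _
    exact RingHom.ker_isMaximal_of_surjective χ hχs
  obtain ⟨_, -, huniq⟩ := h.existsUnique_lift (h.1.quotient y.asIdeal)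
    ((Ideal.Quotient.mkₐ L y.asIdeal).comp φ)
    (spPreimage_comp_eq_univ h.2.1 _ Ideal.Quotient.mk_surjective)
  let ψ : A ⧸ z.asIdeal →ₐ[L] A' ⧸ y.asIdeal := Ideal.quotientMapₐ y.asIdeal φ hy.ge
  have h1 : ψ.comp χ = Ideal.Quotient.mkₐ L y.asIdeal := by
    refine (huniq _ ?_).trans (huniq _ rfl).symm
    change (ψ.comp χ).comp φ = _
    rw [AlgHom.comp_assoc, hχ]
    rfl
  refine (hk.eq_of_le y.isMaximal.ne_top fun a ha => ?_).symm
  rw [← Ideal.Quotient.eq_zero_iff_mem]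
  change Ideal.Quotient.mkₐ L y.asIdeal a = 0
  rw [← h1, AlgHom.comp_apply, (RingHom.mem_ker).1 ha, map_zero]

theorem Represents.exists_comap_eq (hA : IsAffinoidAlgebra L A) (h : Represents φ W)
    {z : MaximalSpectrum A} (hz : z ∈ W) :
    ∃ y : MaximalSpectrum A', y.asIdeal.comap φ = z.asIdeal := by
  obtain ⟨χ, hχ, -⟩ := h.exists_algHom_quotient hA hz
  have hzm := z.isMaximal
  have hχs : Function.Surjective χ := fun a => by
    obtain ⟨b, rfl⟩ := Ideal.Quotient.mk_surjective a
    exact ⟨φ b, DFunLike.congr_fun hχ b⟩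
  have hk : (RingHom.ker χ).IsMaximal := by
    let : Field (A ⧸ z.asIdeal) := Ideal.Quotient.field _
    exact RingHom.ker_isMaximal_of_surjective χ hχs
  refine ⟨⟨RingHom.ker χ, hk⟩, Ideal.ext fun a => ?_⟩
  rw [Ideal.mem_comap, RingHom.mem_ker, ← Ideal.Quotient.eq_zero_iff_mem]
  exact (DFunLike.congr_fun hχ a).congr_left

theorem Represents.eq_of_comap_eq (hA : IsAffinoidAlgebra L A) (h : Represents φ W)
    {y y' : MaximalSpectrum A'} (hy : y.asIdeal.comap φ = y'.asIdeal.comap φ) : y = y' := by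
  obtain ⟨z, hz, hzy⟩ := spPreimage_eq_univ_iff.1 h.2.1 y
  obtain ⟨χ, -, hχ⟩ := h.exists_algHom_quotient hA hz
  exact MaximalSpectrum.ext ((hχ y hzy.symm).trans (hχ y' (hy ▸ hzy.symm)).symm)

theorem Represents.isUnit_of_forall_notMem (h : Represents φ W) {f : A}
    (hf : ∀ z ∈ W, f ∉ z.asIdeal) : IsUnit (φ f) := by
  by_contra hu
  obtain ⟨y, hy, hfy⟩ := exists_max_ideal_of_mem_nonunits hu
  obtain ⟨z, hz, hzy⟩ := spPreimage_eq_univ_iff.1 h.2.1 ⟨y, hy⟩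
  exact hf z hz (hzy ▸ hfy)

/-- Evaluation at a point of a smaller subdomain. -/
theorem Represents.notMem_of_isUnit (p : ℕ) [Fact p.Prime] [NormedAlgebra ℚ_[p] L]
    [FiniteDimensional ℚ_[p] L] (hA : IsAffinoidAlgebra L A) (h : Represents φ W)
    {A'' : Type*} [CommRing A''] [Algebra L A''] {ρ : A' →ₐ[L] A''} {W' : Set (MaximalSpectrum A)}
    (h' : Represents (ρ.comp φ) W') {y : MaximalSpectrum A'} {z : MaximalSpectrum A} (hz : z ∈ W')
    (hy : y.asIdeal.comap φ = z.asIdeal) {g : A'} (hg : IsUnit (ρ g)) : g ∉ y.asIdeal := by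
  obtain ⟨y', hy'⟩ := h'.exists_comap_eq hA hz
  have := y'.isMaximal
  have h1 : (⟨y'.asIdeal.comap ρ, h'.1.isMaximal_comap p ρ y'.asIdeal⟩ : MaximalSpectrum A') = y :=
    h.eq_of_comap_eq hA (by rw [hy, ← hy']; rfl)
  rw [← h1]
  exact fun hgy => y'.isMaximal.ne_top (Ideal.eq_top_of_isUnit_mem _ hgy hg)

end Points

/-! ### Functoriality of rational subdomains and finite refinements. -/

section Refinement

variable {L : Type u} [NontriviallyNormedField L]
  {A : Type*} [CommRing A] [Algebra L A] {B : Type*} [CommRing B] [Algebra L B]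

theorem absAt_eq_of_eq_comap (φ : A →ₐ[L] B) {x : MaximalSpectrum A} {y : MaximalSpectrum B}
    (h : x.asIdeal = y.asIdeal.comap φ) (f : A) : absAt L x f = absAt L y (φ f) := by
  let ψ : A ⧸ x.asIdeal →ₐ[L] B ⧸ y.asIdeal := Ideal.quotientMapₐ y.asIdeal φ h.le
  have hψ : Function.Injective ψ := Ideal.quotientMap_injective' (H := h.le) h.ge
  rw [absAt, absAt, ← minpoly.algHom_eq ψ hψ]
  rfl

theorem IsRationalSubdomain.spPreimage {W : Set (MaximalSpectrum A)}
    (hW : IsRationalSubdomain L W) (φ : A →ₐ[L] B) (hφ : Function.Surjective φ) :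
    IsRationalSubdomain L (spPreimage φ W) := by
  obtain ⟨r, f, g, hspan, rfl⟩ := hW
  refine ⟨r, fun i => φ (f i), φ g, ?_, Set.ext fun y => ⟨?_, fun hy => ?_⟩⟩
  · have := congrArg (Ideal.map φ) hspan
    rwa [Ideal.map_span, Set.image_insert_eq, ← Set.range_comp, Ideal.map_top] at this
  · rintro ⟨x, hx, hxy⟩ i
    rw [← absAt_eq_of_eq_comap φ hxy, ← absAt_eq_of_eq_comap φ hxy]
    exact hx i
  · have := y.isMaximal
    refine ⟨⟨y.asIdeal.comap φ, Ideal.comap_isMaximal_of_surjective φ hφ⟩, fun i => ?_, rfl⟩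
    rw [absAt_eq_of_eq_comap φ rfl, absAt_eq_of_eq_comap φ rfl]
    exact hy i

variable [IsUltrametricDist L]

/-- The hypothesis only tests algebras in the universe of `L`, so it is applied to an isomorphic
copy of `A` and the covering is carried back. -/
theorem PullsBackToFinite.hasFiniteRationalRefinement (hA : IsAffinoidAlgebra L A)
    {𝒰 : Set (Set (MaximalSpectrum A))} (h : PullsBackToFinite L Set.univ 𝒰) :
    HasFiniteRationalRefinement L 𝒰 := by
  obtain ⟨B, _, _, hB, ⟨σ⟩⟩ := hA.exists_algEquiv
  obtain ⟨𝓕, hfin, hrat, hcov, href⟩ := h B hB σ.toAlgHom (spPreimage_eq_univ_iff.2 fun y => by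
    have := y.isMaximal
    exact ⟨⟨y.asIdeal.comap σ.toAlgHom, Ideal.comap_isMaximal_of_surjective _ σ.surjective⟩,
      trivial, rfl⟩)
  refine ⟨spPreimage σ.symm.toAlgHom '' 𝓕, hfin.image _, ?_, ?_, ?_⟩
  · rintro _ ⟨F, hF, rfl⟩
    exact (hrat F hF).spPreimage _ σ.symm.surjective
  · refine Set.eq_univ_of_forall fun x => ?_
    have := x.isMaximal
    let y : MaximalSpectrum B := ⟨x.asIdeal.comap σ.symm.toAlgHom,
      Ideal.comap_isMaximal_of_surjective _ σ.symm.surjective⟩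
    obtain ⟨F, hF, hyF⟩ := (hcov ▸ Set.mem_univ y : y ∈ ⋃₀ 𝓕)
    exact ⟨_, ⟨F, hF, rfl⟩, y, hyF, rfl⟩
  · rintro _ ⟨F, hF, rfl⟩
    obtain ⟨_, ⟨U, hU, rfl⟩, hFU⟩ := href F hF
    refine ⟨U, hU, ?_⟩
    rintro x ⟨y, hy, hyx⟩
    obtain ⟨x', hx', hxy⟩ := hFU hy
    have : x' = x := MaximalSpectrum.ext (by
      rw [hxy, hyx]
      ext a
      simp [Ideal.mem_comap])
    exact this ▸ hx'

end Refinement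

/-! ### Dimension under base change along an injective map of maximal spectra. -/

section Fibre

variable {L : Type*} [NontriviallyNormedField L] [IsUltrametricDist L]
  {A B A' : Type*} [CommRing A] [Algebra L A] [CommRing B] [Algebra L B] [CommRing A']
  [Algebra L A']

/-- If `Sp A' → Sp A` is injective then base change along it does not increase the dimension of
closed subspaces of `Sp A`. -/
theorem ringKrullDim_quotient_map_ker_le (p : ℕ) [Fact p.Prime] [NormedAlgebra ℚ_[p] L]
    [FiniteDimensional ℚ_[p] L] (hA' : IsAffinoidAlgebra L A') (r : A →ₐ[L] A')
    (hr : ∀ y y' : MaximalSpectrum A', y.asIdeal.comap r = y'.asIdeal.comap r → y = y')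
    (π : A →ₐ[L] B) (hπ : Function.Surjective π) (hB : IsNoetherianRing B) :
    ringKrullDim (A' ⧸ (RingHom.ker π).map r) ≤ ringKrullDim B := by
  have hC := hA'.quotient ((RingHom.ker π).map r)
  have hCN := hC.isNoetherianRing p
  let mkC := Ideal.Quotient.mkₐ L ((RingHom.ker π).map r)
  have hmkC : Function.Surjective mkC := Ideal.Quotient.mk_surjective
  obtain ⟨η, hη⟩ : ∃ η : B →+* A' ⧸ (RingHom.ker π).map r, ∀ a, η (π a) = mkC (r a) := by
    let g : A →+* A' ⧸ (RingHom.ker π).map r := (mkC.comp r : A →ₐ[L] _)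
    have hg : ∀ a ∈ RingHom.ker (π : A →+* B), g a = 0 := fun a ha =>
      Ideal.Quotient.eq_zero_iff_mem.2
        (Ideal.mem_map_of_mem r (show a ∈ RingHom.ker π from ha))
    let η := (Ideal.Quotient.lift (RingHom.ker (π : A →+* B)) g hg).comp
        (RingHom.quotientKerEquivOfSurjective (f := (π : A →+* B)) hπ).symm.toRingHom
    refine ⟨η, fun a => ?_⟩
    have : (RingHom.quotientKerEquivOfSurjective (f := (π : A →+* B)) hπ).symm (π a) =
        Ideal.Quotient.mk _ a := (RingEquiv.symm_apply_eq _).2 rfl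
    change Ideal.Quotient.lift (RingHom.ker (π : A →+* B)) g hg
      ((RingHom.quotientKerEquivOfSurjective (f := (π : A →+* B)) hπ).symm (π a)) = _
    rw [this]
    rfl
  let : Algebra B (A' ⧸ (RingHom.ker π).map r) := η.toAlgebra
  refine (ringKrullDim_le_iff_isMaximal_height_le _).2 fun c hc => ?_
  have hcp := hc.isPrime
  let b := c.comap η
  have hover : c.LiesOver b := ⟨rfl⟩
  have hbc : b.map (algebraMap B (A' ⧸ (RingHom.ker π).map r)) ≤ c := Ideal.map_comap_le
  -- The fibre over `b` has no prime strictly below `c`: by injectivity `c` is the only maximal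
  -- ideal above such a `q`, so the quotient by `q` is an affinoid domain with at most one maximal
  -- ideal, hence a field.
  have hq : ∀ q : Ideal (A' ⧸ (RingHom.ker π).map r), q.IsPrime →
      b.map (algebraMap B (A' ⧸ (RingHom.ker π).map r)) ≤ q → q ≤ c → q = c := by
    intro q hqp hbq hqc
    have hmax : ∀ t : Ideal (A' ⧸ (RingHom.ker π).map r), t.IsMaximal → q ≤ t → t = c := by
      intro t ht hqt
      have h1 : (t.comap mkC).IsMaximal := Ideal.comap_isMaximal_of_surjective _ hmkC
      have h2 : (c.comap mkC).IsMaximal := Ideal.comap_isMaximal_of_surjective _ hmkC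
      have h3 : (c.comap mkC).comap r = (t.comap mkC).comap r :=
        (hA'.isMaximal_comap p r (c.comap mkC)).eq_of_le
          (hA'.isMaximal_comap p r (t.comap mkC)).ne_top fun a ha => by
            refine hqt (hbq ?_)
            change mkC (r a) ∈ _
            rw [← hη]
            refine Ideal.mem_map_of_mem (algebraMap B _) ?_
            change η (π a) ∈ c
            rw [hη]
            exact ha
      have h4 := congrArg MaximalSpectrum.asIdeal (hr ⟨_, h2⟩ ⟨_, h1⟩ h3)
      exact (Ideal.comap_injective_of_surjective mkC hmkC h4).symm
    have hcount : Countable (MaximalSpectrum ((A' ⧸ (RingHom.ker π).map r) ⧸ q)) := by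
      have hsub : Subsingleton (MaximalSpectrum ((A' ⧸ (RingHom.ker π).map r) ⧸ q)) := by
        refine ⟨fun t t' => MaximalSpectrum.ext
          (Ideal.comap_injective_of_surjective _ (Ideal.Quotient.mk_surjective (I := q)) ?_)⟩
        have key : ∀ t : MaximalSpectrum ((A' ⧸ (RingHom.ker π).map r) ⧸ q),
            t.asIdeal.comap (Ideal.Quotient.mk q) = c := fun t => by
          have := t.isMaximal
          refine hmax _ (Ideal.comap_isMaximal_of_surjective _ Ideal.Quotient.mk_surjective)
            fun a ha => ?_
          rw [Ideal.mem_comap, Ideal.Quotient.eq_zero_iff_mem.2 ha]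
          exact zero_mem _
        rw [key, key]
      infer_instance
    exact (Ideal.Quotient.maximal_of_isField q
      ((hC.quotient q).isField_of_countable p hcount)).eq_of_le hc.ne_top hqc
  -- The height of `c` is at most that of `b` plus that of `c` in the fibre, and the latter is zero.
  have h1 := Ideal.height_le_height_add_of_liesOver b c
  have hmk := Ideal.Quotient.mk_surjective
    (I := b.map (algebraMap B (A' ⧸ (RingHom.ker π).map r)))
  have hker : RingHom.ker (Ideal.Quotient.mk
      (b.map (algebraMap B (A' ⧸ (RingHom.ker π).map r)))) ≤ c := by rwa [Ideal.mk_ker]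
  have hprime := Ideal.map_isPrime_of_surjective hmk hker
  have h2 : (c.map (Ideal.Quotient.mk
      (b.map (algebraMap B (A' ⧸ (RingHom.ker π).map r))))).height = 0 := by
    refine Ideal.height_eq_zero_iff.2 ⟨⟨hprime, bot_le⟩, fun q hqp hqle => ?_⟩
    have hqp' : q.IsPrime := hqp.1
    have h3 := hq (q.comap (Ideal.Quotient.mk _)) inferInstance (fun a ha => by
        rw [Ideal.mem_comap, Ideal.Quotient.eq_zero_iff_mem.2 ha]
        exact zero_mem _) ((Ideal.comap_mono hqle).trans (by
        rw [Ideal.comap_map_of_surjective _ hmk, ← RingHom.ker_eq_comap_bot]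
        exact sup_le le_rfl hker))
    rw [← h3]
    exact Ideal.map_comap_le
  rw [h2, add_zero] at h1
  exact le_trans (by exact_mod_cast h1) Ideal.height_le_ringKrullDim_of_isPrime

end Fibre

/-! ### Affinoid charts: points, germs and coverings. -/

section Charts

variable {L : Type u} [NontriviallyNormedField L] [IsUltrametricDist L]
  {X : GRingedSpace.{u, v, w} L} {U : X.top.Opens}

namespace GRingedSpace.IsAffinoid

/-- The identification of an affinoid open subspace with a maximal spectrum. -/
noncomputable def equiv (hU : X.IsAffinoid U) : U.1 ≃ MaximalSpectrum (X.sec U) := hU.2.choose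

/-- The subset of `X` which corresponds to a subset of the maximal spectrum. -/
def toSet (hU : X.IsAffinoid U) (W : Set (MaximalSpectrum (X.sec U))) : Set X.carrier :=
  Subtype.val '' (hU.equiv ⁻¹' W)

theorem toSet_subset (hU : X.IsAffinoid U) (W : Set (MaximalSpectrum (X.sec U))) :
    hU.toSet W ⊆ U.1 := by
  rintro _ ⟨x, -, rfl⟩
  exact x.2

theorem mem_toSet (hU : X.IsAffinoid U) {W : Set (MaximalSpectrum (X.sec U))} (x : U.1) :
    x.1 ∈ hU.toSet W ↔ hU.equiv x ∈ W :=
  ⟨fun ⟨_, hy, hyx⟩ => Subtype.ext hyx ▸ hy, fun h => ⟨x, h, rfl⟩⟩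

theorem toSet_image (hU : X.IsAffinoid U) (V : Set X.carrier) :
    hU.toSet (hU.equiv '' (Subtype.val ⁻¹' V)) = U.1 ∩ V := by
  rw [toSet, Equiv.preimage_image, Subtype.image_preimage_coe]

theorem isOpen_toSet_iff (hU : X.IsAffinoid U) (W : Set (MaximalSpectrum (X.sec U))) :
    X.top.IsOpen (hU.toSet W) ↔ IsSpOpen L W := hU.2.choose_spec.1 W

theorem isCover_toSet_iff (hU : X.IsAffinoid U) (W : Set (MaximalSpectrum (X.sec U)))
    (𝒲 : Set (Set (MaximalSpectrum (X.sec U)))) :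
    X.top.IsCover (hU.toSet W) (hU.toSet '' 𝒲) ↔ IsSpCover L W 𝒲 := hU.2.choose_spec.2.1 W 𝒲

/-- The admissible open subset which corresponds to a rational subdomain. -/
def opens (hU : X.IsAffinoid U) {W : Set (MaximalSpectrum (X.sec U))}
    (hW : IsRationalSubdomain L W) : X.top.Opens :=
  ⟨hU.toSet W, (hU.isOpen_toSet_iff W).2 hW.isSpOpen⟩

theorem represents (hU : X.IsAffinoid U) {W : Set (MaximalSpectrum (X.sec U))}
    (hW : IsRationalSubdomain L W) :
    Represents (X.res (V := hU.opens hW) (hU.toSet_subset W)) W :=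
  hU.2.choose_spec.2.2 W (hU.opens hW) (hU.toSet_subset W) hW rfl

theorem exists_rational_mem (hU : X.IsAffinoid U) {V : Set X.carrier} (hV : X.top.IsOpen V)
    (hVU : V ⊆ U.1) (x : U.1) (hx : x.1 ∈ V) :
    ∃ W : Set (MaximalSpectrum (X.sec U)), IsRationalSubdomain L W ∧ hU.equiv x ∈ W ∧
      hU.toSet W ⊆ V := by
  have hVeq : hU.toSet (hU.equiv '' (Subtype.val ⁻¹' V)) = V := by
    rw [toSet_image, Set.inter_eq_right.2 hVU]
  obtain ⟨𝒰, hrat, hun, -⟩ := (hU.isOpen_toSet_iff (hU.equiv '' (Subtype.val ⁻¹' V))).1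
    (hVeq.symm ▸ hV)
  have hxm : hU.equiv x ∈ ⋃₀ 𝒰 := hun ▸ ⟨x, hx, rfl⟩
  obtain ⟨W, hW, hxW⟩ := hxm
  refine ⟨W, hrat W hW, hxW, ?_⟩
  rw [← hVeq]
  exact Set.image_mono (Set.preimage_mono (hun ▸ Set.subset_sUnion_of_mem hW))

/-- A chart is only a bijection on points. With `isUnitAt_of_notMem`, this recovers the maximal
ideal of `x` from the sheaf alone, as the sections whose germ at `x` is not a unit; this is what
allows charts to be compared. -/
theorem notMem_of_isUnitAt (hU : X.IsAffinoid U) {f : X.sec U} {x : U.1}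
    (h : X.IsUnitAt f x) : f ∉ (hU.equiv x).asIdeal := by
  obtain ⟨V, hVU, hxV, hu⟩ := h
  obtain ⟨W, hW, hxW, hWV⟩ := hU.exists_rational_mem V.2 hVU x hxV
  obtain ⟨y, hy⟩ := (hU.represents hW).exists_comap_eq hU.1 hxW
  have hu' := hu.map (X.res (V := hU.opens hW) hWV)
  rw [X.res_res (W := hU.opens hW) hVU hWV f] at hu'
  rw [← hy]
  exact fun hf => y.isMaximal.ne_top (Ideal.eq_top_of_isUnit_mem _ hf hu')

theorem isUnitAt_of_notMem (p : ℕ) [Fact p.Prime] [NormedAlgebra ℚ_[p] L]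
    [FiniteDimensional ℚ_[p] L] (hU : X.IsAffinoid U) {f : X.sec U} {x : U.1}
    (h : f ∉ (hU.equiv x).asIdeal) : X.IsUnitAt f x := by
  obtain ⟨k, hk⟩ := exists_pow_lt_of_lt_one (hU.1.absAt_pos p h) (norm_natCast_prime_lt_one L p)
  have hne : (p : L) ^ k ≠ 0 := pow_ne_zero _ (natCast_prime_ne_zero L p)
  -- With `‖p‖ ^ k < |f(x)|`, this subdomain contains `x` and `f` has no zero on it.
  let W : Set (MaximalSpectrum (X.sec U)) :=
    {z | ∀ _ : Fin 1, absAt L z (algebraMap L (X.sec U) ((p : L) ^ k)) ≤ absAt L z f}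
  have hW : IsRationalSubdomain L W := by
    refine ⟨1, fun _ => algebraMap L (X.sec U) ((p : L) ^ k), f, ?_, rfl⟩
    refine Ideal.eq_top_of_isUnit_mem _ (Ideal.subset_span (Or.inr ⟨0, rfl⟩))
      (hne.isUnit.map (algebraMap L (X.sec U)))
  refine ⟨hU.opens hW, hU.toSet_subset W, (hU.mem_toSet x).2 fun _ => ?_,
    (hU.represents hW).isUnit_of_forall_notMem fun z hz hfz => ?_⟩
  · rw [absAt_algebraMap, norm_pow]
    exact hk.le
  · have h1 := hz 0
    rw [absAt_of_mem hfz, absAt_algebraMap] at h1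
    exact hne (norm_le_zero_iff.1 h1)

theorem exists_finite_rational_refinement (hU : X.IsAffinoid U) {𝒰 : Set (Set X.carrier)}
    (h𝒰 : X.top.IsCover Set.univ 𝒰) :
    ∃ 𝓕 : Set (Set (MaximalSpectrum (X.sec U))), 𝓕.Finite ∧
      (∀ W ∈ 𝓕, IsRationalSubdomain L W) ∧ ⋃₀ 𝓕 = Set.univ ∧
      ∀ W ∈ 𝓕, ∃ V ∈ 𝒰, hU.toSet W ⊆ V := by
  have h1 := X.top.cover_inter h𝒰 U.2 (Set.subset_univ _)
  have h2 : hU.toSet Set.univ = U.1 := by simp [toSet]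
  have h3 : hU.toSet '' ((fun V => hU.equiv '' (Subtype.val ⁻¹' V)) '' 𝒰) =
      (fun V => U.1 ∩ V) '' 𝒰 := by
    rw [Set.image_image]
    simp only [toSet_image]
  rw [← h3] at h1
  have h4 := (hU.isCover_toSet_iff Set.univ _).1 (by rw [h2]; exact h1)
  obtain ⟨𝓕, hfin, hrat, hcov, href⟩ := h4.2.2.2.hasFiniteRationalRefinement hU.1
  refine ⟨𝓕, hfin, hrat, hcov, fun W hW => ?_⟩
  obtain ⟨_, ⟨V, hV, rfl⟩, hWV⟩ := href W hW
  refine ⟨V, hV, (Set.image_mono (Set.preimage_mono hWV)).trans ?_⟩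
  exact (hU.toSet_image V).subset.trans Set.inter_subset_right

end GRingedSpace.IsAffinoid

end Charts

/-! ### Comparison of two charts, and the pieces of a closed subspace inside a chart. -/

section Cover

variable {L : Type u} [NontriviallyNormedField L] [IsUltrametricDist L]

/-- Points of a rational subdomain of `U` which is contained in an affinoid open `V`, viewed as
points of `V`. -/
theorem GRingedSpace.IsAffinoid.comap_res_eq (p : ℕ) [Fact p.Prime] [NormedAlgebra ℚ_[p] L]
    [FiniteDimensional ℚ_[p] L] {X : GRingedSpace.{u, v, w} L} {U V : X.top.Opens}
    (hU : X.IsAffinoid U) (hV : X.IsAffinoid V) {W : Set (MaximalSpectrum (X.sec U))}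
    (hW : IsRationalSubdomain L W) (hWV : (hU.opens hW).1 ⊆ V.1) {x : X.carrier} (hxU : x ∈ U.1)
    (hxW : x ∈ hU.toSet W) {y : MaximalSpectrum (X.sec (hU.opens hW))}
    (hy : y.asIdeal.comap (X.res (V := hU.opens hW) (hU.toSet_subset W)) =
      (hU.equiv ⟨x, hxU⟩).asIdeal) :
    y.asIdeal.comap (X.res hWV) = (hV.equiv ⟨x, hWV hxW⟩).asIdeal := by
  have hrep := hU.represents hW
  have := y.isMaximal
  have hmax := hrep.1.isMaximal_comap p (X.res hWV) y.asIdeal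
  -- One inclusion suffices, both ideals being maximal. If `f` did not vanish at `x` in the chart
  -- `V`, it would be a unit on a smaller rational subdomain of `U` around `x`, so it could not lie
  -- in the pullback of `y`.
  refine hmax.eq_of_le (hV.equiv ⟨x, hWV hxW⟩).isMaximal.ne_top fun f hf => ?_
  by_contra hfx
  obtain ⟨V', hV'V, hxV', hu⟩ := hV.isUnitAt_of_notMem p hfx
  obtain ⟨W', hW', hxW', hW'V⟩ := hU.exists_rational_mem (X.top.inter V'.2 (hU.opens hW).2)
    (Set.inter_subset_right.trans (hU.toSet_subset W)) ⟨x, hxU⟩ ⟨hxV', hxW⟩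
  have h1 : (hU.opens hW').1 ⊆ (hU.opens hW).1 := hW'V.trans Set.inter_subset_right
  have h2 : (hU.opens hW').1 ⊆ V'.1 := hW'V.trans Set.inter_subset_left
  have hrep' : Represents ((X.res h1).comp (X.res (V := hU.opens hW) (hU.toSet_subset W))) W' := by
    have h3 : (X.res h1).comp (X.res (V := hU.opens hW) (hU.toSet_subset W)) =
        X.res (V := hU.opens hW') (hU.toSet_subset W') :=
      AlgHom.ext fun a => X.res_res _ _ a
    rw [h3]
    exact hU.represents hW'
  refine hrep.notMem_of_isUnit p hU.1 hrep' hxW' hy ?_ hf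
  have hu' := hu.map (X.res h2)
  rw [X.res_res hV'V h2 f] at hu'
  rwa [X.res_res hWV h1 f]

theorem RigidSpace.Hom.exists_algHom_of_toSet_subset (p : ℕ) [Fact p.Prime] [NormedAlgebra ℚ_[p] L]
    [FiniteDimensional ℚ_[p] L] {Y : RigidSpace.{u, v, w} L} {X : RigidSpace.{u, v', w'} L}
    (i : Y.Hom X) {U V : X.top.Opens} (hU : X.IsAffinoid U) (hV : X.IsAffinoid V)
    (hY : Y.IsAffinoid ⟨i.toFun ⁻¹' V.1, i.isOpen_preimage V.2⟩)
    (hi : Function.Surjective (i.comap V)) {W : Set (MaximalSpectrum (X.sec U))}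
    (hW : IsRationalSubdomain L W) (hWV : (hU.opens hW).1 ⊆ V.1) :
    ∃ (C : Type w') (_ : CommRing C) (_ : Algebra L C) (φ : X.sec U →ₐ[L] C),
      IsNoetherianRing C ∧ ringKrullDim C ≤ Y.dim ∧
      ∀ (y : Y.carrier) (hy : i.toFun y ∈ U.1), i.toFun y ∈ hU.toSet W →
        ∃ c : MaximalSpectrum C, (hU.equiv ⟨_, hy⟩).asIdeal = c.asIdeal.comap φ := by
  have hrep := hU.represents hW
  let r := X.res hWV
  let mkC := Ideal.Quotient.mkₐ L ((RingHom.ker (i.comap V)).map r)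
  have hpt : ∀ y : MaximalSpectrum (X.sec (hU.opens hW)), ∃ (x : X.carrier) (hxU : x ∈ U.1)
      (hxW : x ∈ hU.toSet W), y.asIdeal.comap (X.res (V := hU.opens hW) (hU.toSet_subset W)) =
        (hU.equiv ⟨x, hxU⟩).asIdeal ∧
      y.asIdeal.comap r = (hV.equiv ⟨x, hWV hxW⟩).asIdeal := fun y => by
    obtain ⟨z, hz, hzy⟩ := spPreimage_eq_univ_iff.1 hrep.2.1 y
    obtain ⟨x, rfl⟩ := hU.equiv.surjective z
    exact ⟨x, x.2, (hU.mem_toSet x).2 hz, hzy.symm,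
      hU.comap_res_eq p hV hW hWV x.2 ((hU.mem_toSet x).2 hz) hzy.symm⟩
  have hinj : ∀ y y' : MaximalSpectrum (X.sec (hU.opens hW)),
      y.asIdeal.comap r = y'.asIdeal.comap r → y = y' := fun y y' h => by
    obtain ⟨x, hxU, hxW, h1, h2⟩ := hpt y
    obtain ⟨x', hxU', hxW', h1', h2'⟩ := hpt y'
    have h3 := hV.equiv.injective (MaximalSpectrum.ext (h2.symm.trans (h.trans h2')))
    obtain rfl : x = x' := congrArg Subtype.val h3
    exact hrep.eq_of_comap_eq hU.1 (h1.trans h1'.symm)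
  refine ⟨X.sec (hU.opens hW) ⧸ (RingHom.ker (i.comap V)).map r, inferInstance, inferInstance,
    mkC.comp (X.res (V := hU.opens hW) (hU.toSet_subset W)),
    (hrep.1.quotient _).isNoetherianRing p, ?_, fun y hyU hyW => ?_⟩
  · refine (ringKrullDim_quotient_map_ker_le p hrep.1 r hinj (i.comap V) hi
      (hY.1.isNoetherianRing p)).trans ?_
    exact le_iSup (fun U : {U : Y.top.Opens // Y.IsAffinoid U} => ringKrullDim (Y.sec U.1)) ⟨_, hY⟩
  · obtain ⟨t, ht⟩ := hrep.exists_comap_eq hU.1 ((hU.mem_toSet ⟨_, hyU⟩).1 hyW)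
    have ht' := hU.comap_res_eq p hV hW hWV hyU hyW ht
    -- A section in the kernel pulls back to zero on `Y`. Were it nonzero at `i y`, its germ there
    -- would be a unit, and so would the germ of zero at `y`.
    have hle : (RingHom.ker (i.comap V)).map r ≤ t.asIdeal := by
      refine Ideal.map_le_iff_le_comap.2 (ht'.symm ▸ fun f hf => ?_)
      by_contra hfx
      obtain ⟨V', hV'V, hyV', hu⟩ := hV.isUnitAt_of_notMem p hfx
      have hu0 : Y.IsUnitAt (i.comap V f) y := by
        refine ⟨⟨i.toFun ⁻¹' V'.1, i.isOpen_preimage V'.2⟩, fun _ h => hV'V h, hyV', ?_⟩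
        rw [← i.comap_res hV'V]
        exact hu.map _
      refine hY.notMem_of_isUnitAt (x := ⟨y, hWV hyW⟩) hu0 ?_
      rw [RingHom.mem_ker.1 hf]
      exact zero_mem _
    have hmkC : Function.Surjective mkC := Ideal.Quotient.mk_surjective
    have hct : (t.asIdeal.map mkC).comap mkC = t.asIdeal := by
      rw [Ideal.comap_map_of_surjective _ hmkC]
      refine le_antisymm (sup_le le_rfl fun a ha => hle ?_) le_sup_left
      exact Ideal.Quotient.eq_zero_iff_mem.1 ha
    have hcm : (t.asIdeal.map mkC).IsMaximal := by
      have := t.isMaximal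
      refine (Ideal.map_eq_top_or_isMaximal_of_surjective mkC hmkC t.isMaximal).resolve_left
        fun h => t.isMaximal.ne_top ?_
      rw [← hct, h, Ideal.comap_top]
    refine ⟨⟨_, hcm⟩, ?_⟩
    rw [← ht]
    conv_lhs => rw [← hct]
    rfl

end Cover

end Rigid

theorem mainTheorem9 {p : ℕ} [Fact p.Prime]
    {L : Type*} [NontriviallyNormedField L] [IsUltrametricDist L]
    [NormedAlgebra ℚ_[p] L] [FiniteDimensional ℚ_[p] L]
    (n : ℕ) (X : Rigid.RigidSpace L) (hX : X.dim = n)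
    (Y : ℕ → Rigid.RigidSpace L) (i : ∀ j, (Y j).Hom X) (hi : ∀ j, (i j).IsClosedImmersion)
    (hY : ∀ j, (Y j).dim < n) :
    ⋃ j, Set.range (i j).toFun ≠ Set.univ := by
  intro hcover
  obtain ⟨⟨U, hU⟩, hUn⟩ : ∃ U : {U : X.top.Opens // X.IsAffinoid U},
      (n : WithBot ℕ∞) ≤ ringKrullDim (X.sec U.1) := by
    by_contra! h
    rw [Rigid.RigidSpace.dim] at hX
    -- If all dimensions are `< n`, their supremum is at most the predecessor of `n`, which is `⊥`
    -- for `n = 0`.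
    obtain _ | k := n
    · have h1 : (⨆ U : {U : X.top.Opens // X.IsAffinoid U}, ringKrullDim (X.sec U.1)) ≤ ⊥ :=
        iSup_le fun U => by
          have := h U
          rcases hd : ringKrullDim (X.sec U.1) with _ | d
          · exact le_rfl
          · rw [hd] at this
            exact absurd this (not_lt.2 (WithBot.coe_le_coe.2 (zero_le (a := d))))
      rw [hX] at h1
      exact absurd h1 (by simp)
    · have h1 : (⨆ U : {U : X.top.Opens // X.IsAffinoid U}, ringKrullDim (X.sec U.1)) ≤ (k : ℕ) :=
        iSup_le fun U => by
          have := h U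
          rcases hd : ringKrullDim (X.sec U.1) with _ | d
          · exact bot_le
          · rw [hd] at this
            have h2 : d < ((k + 1 : ℕ) : ℕ∞) := WithBot.coe_lt_coe.1 this
            have h3 : d ≤ (k : ℕ∞) := Order.le_of_lt_add_one (by exact_mod_cast h2)
            exact WithBot.coe_le_coe.2 h3
      rw [hX] at h1
      have h2 : k + 1 ≤ k := by exact_mod_cast h1
      omega
  choose 𝒰 h𝒰 h𝒰' using hi
  choose 𝓕 hfin hrat hcov href using fun j => hU.exists_finite_rational_refinement (h𝒰 j)
  -- The pieces are indexed by pairs of a `j` and a member of its finite rational covering, a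
  -- countable set.
  have hpiece : ∀ x : Σ j, 𝓕 j, ∃ (C : Type _) (_ : CommRing C) (_ : Algebra L C)
      (φ : X.sec U →ₐ[L] C), IsNoetherianRing C ∧ ringKrullDim C ≤ (Y x.1).dim ∧
      ∀ (y : (Y x.1).carrier) (hy : (i x.1).toFun y ∈ U.1), (i x.1).toFun y ∈ hU.toSet x.2.1 →
        ∃ c : MaximalSpectrum C, (hU.equiv ⟨_, hy⟩).asIdeal = c.asIdeal.comap φ := by
    rintro ⟨j, W, hW⟩
    obtain ⟨V, hV, hWV⟩ := href j W hW
    obtain ⟨h1, h2, h3⟩ := h𝒰' j ⟨V, X.top.isOpen_of_mem (h𝒰 j) V hV⟩ hV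
    exact (i j).exists_algHom_of_toSet_subset p hU h1 h2 h3 (hrat j W hW) hWV
  choose C _ _ φ hN hdim hC using hpiece
  have hcount : Countable (Σ j, 𝓕 j) := by
    have := fun j => (hfin j).countable.to_subtype
    infer_instance
  obtain ⟨z, hz⟩ := Rigid.exists_maximalSpectrum_ne_comap p hU.1 C φ hUn
    fun x => (hdim x).trans_lt (hY x.1)
  obtain ⟨⟨x, hxU⟩, rfl⟩ := hU.equiv.surjective z
  have hx : x ∈ ⋃ j, Set.range (i j).toFun := hcover ▸ Set.mem_univ x
  obtain ⟨j, y, rfl⟩ := Set.mem_iUnion.1 hx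
  obtain ⟨W, hW, hxW⟩ : hU.equiv ⟨_, hxU⟩ ∈ ⋃₀ 𝓕 j := hcov j ▸ Set.mem_univ _
  obtain ⟨c, hc⟩ := hC ⟨j, W, hW⟩ y hxU ((hU.mem_toSet ⟨_, hxU⟩).2 hxW)
  exact hz ⟨j, W, hW⟩ c hc
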